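/- Let $m>1$. For $\sigma>0$ put $\alpha=\frac{\sigma+2}{\sigma(m-1)}$ and $\beta=\frac1\sigma$, and consider the profile equation $$(f^m)''(\xi)-\alpha f(\xi)+\beta\xi f'(\xi)+\xi^{\sigma}f(\xi)=0,\qquad \xi\in[0,\infty). \tag{1}$$ A solution of (1) is a continuous function $f:[0,\infty)\to[0,\infty)$ with $f^m\in C^1([0,\infty))$ that satisfies (1) in divergence form, $\big((f^m)'+\beta\xi f\big)'=(\alpha+\beta-\xi^\sigma)f$ on $(0,\infty)$. A good profile is a solution $f$ of (1) such that either (P1) $f(0)>0$ and $f'(0)=0$, or (P2) $f(0)=0$ and $(f^m)'(0)=0$ (derivatives at $0$ are from the right). It is a good profile with interface if moreover there are $\xi_1\in(0,\infty)$ and $\delta>0$ with $f(\xi_1)=0$, $(f^m)'(\xi_1)=0$ and $f>0$ on $(\xi_1-\delta,\xi_1)$. Theorem. There exists $\sigma_0>0$ (depending only on $m$) such that, for every $\sigma\in(0,\sigma_0)$, every good profile with interface $f$ satisfies $$f(0)=A>0,\qquad f'(0)=0 .$$ Consequently, for every $T>0$, the function $u(x,t)=(T-t)^{-\alpha}f\big(|x|(T-t)^{\beta}\big)$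 is a nonnegative weak solution, continuous on $\mathbb R\times[0,T)$, of $u_t=(u^m)_{xx}+|x|^\sigma u$ in $\mathbb R\times(0,T)$ that blows up globally at time $T$: $u(\cdot,t)$ is bounded for every $t\in[0,T)$, and for every $x\in\mathbb R$ there are $(x_k,t_k)\in\mathbb R\times(0,T)$ with $t_k\to T$, $x_k\to x$ and $|u(x_k,t_k)|\to\infty$. -/

import Mathlib

open Set Filter Topology
open scoped ContDiff

namespace WeightedReaction

/-- The self-similar exponent `α = (σ + 2) / (σ (m - 1))`. -/
noncomputable def alpha (m σ : ℝ) : ℝ := (σ + 2) / (σ * (m - 1))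

/-- The self-similar exponent `β = 1 / σ`. -/
noncomputable def beta (σ : ℝ) : ℝ := 1 / σ

/-- `f` (only its values on `[0, ∞)` matter) is a nonnegative solution on `[0, ∞)` of
`(f^m)'' - α f + β ξ f' + ξ^σ f = 0`.

At an interface `f` itself need not be differentiable (it behaves like
`(ξ₁ - ξ)^(1/(m-1))`), so the equation is understood, as usual for the porous medium operator,
in its divergence form
`((f^m)' + β ξ f)' = (α + β - ξ^σ) f`,
with `f` continuous and `f^m` continuously differentiable. For such `f` this is the same as the
equation in the sense of distributions on `(0, ∞)`, and wherever `f > 0` it is the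
equation in the classical sense. -/
structure IsProfile (m σ : ℝ) (f : ℝ → ℝ) : Prop where
  nonneg : ∀ ξ, 0 ≤ ξ → 0 ≤ f ξ
  continuousOn : ContinuousOn f (Ici 0)
  pow_contDiffOn : ContDiffOn ℝ 1 (fun ξ => f ξ ^ m) (Ici 0)
  equation : ∀ ξ, 0 < ξ →
    HasDerivAt (fun s => deriv (fun r => f r ^ m) s + beta σ * s * f s)
      ((alpha m σ + beta σ - ξ ^ σ) * f ξ) ξ

/-- Property (P1): `f(0) = a > 0` and `f'(0) = 0` (derivative from the right). -/
def StartsPositive (f : ℝ → ℝ) : Prop :=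
  0 < f 0 ∧ HasDerivWithinAt f 0 (Ici 0) 0

/-- Property (P2): `f(0) = 0` and `(f^m)'(0) = 0` (derivative from the right). -/
def StartsZero (m : ℝ) (f : ℝ → ℝ) : Prop :=
  f 0 = 0 ∧ HasDerivWithinAt (fun ξ => f ξ ^ m) 0 (Ici 0) 0

/-- A good profile: a solution with (P1) or (P2). -/
def IsGoodProfile (m σ : ℝ) (f : ℝ → ℝ) : Prop :=
  IsProfile m σ f ∧ (StartsPositive f ∨ StartsZero m f)

/-- `f` has an interface at `ξ₁`: `f(ξ₁) = 0`, `(f^m)'(ξ₁) = 0` and `f > 0` on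
`(ξ₁ - δ, ξ₁)` for some `δ > 0`. -/
def HasInterfaceAt (m : ℝ) (f : ℝ → ℝ) (ξ₁ : ℝ) : Prop :=
  f ξ₁ = 0 ∧ HasDerivAt (fun ξ => f ξ ^ m) 0 ξ₁ ∧
    ∃ δ > 0, ∀ ξ ∈ Ioo (ξ₁ - δ) ξ₁, 0 < f ξ

/-- A good profile with interface at some point of `(0, ∞)`. -/
def IsGoodProfileWithInterface (m σ : ℝ) (f : ℝ → ℝ) : Prop :=
  IsGoodProfile m σ f ∧ ∃ ξ₁ > 0, HasInterfaceAt m f ξ₁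

/-- The self-similar function `u(x,t) = (T - t)^(-α) f(|x| (T - t)^β)` with profile `f`. -/
noncomputable def selfSimilar (m σ T : ℝ) (f : ℝ → ℝ) (x t : ℝ) : ℝ :=
  (T - t) ^ (-alpha m σ) * f (|x| * (T - t) ^ beta σ)

/-- `u` is a nonnegative continuous weak solution of `u_t = (u^m)_xx + |x|^σ u` in
`ℝ × (0, T)`: all derivatives are moved to smooth test functions with compact support in
`ℝ × (0, T)`. (The integrand is continuous with compact support, so the iterated integral is
the integral over `ℝ × (0, T)`.) -/
structure IsWeakSolution (m σ T : ℝ) (u : ℝ → ℝ → ℝ) : Prop where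
  nonneg : ∀ x, ∀ t ∈ Ico 0 T, 0 ≤ u x t
  continuousOn : ContinuousOn (Function.uncurry u) (univ ×ˢ Ico 0 T)
  equation : ∀ φ : ℝ → ℝ → ℝ, ContDiff ℝ ∞ (Function.uncurry φ) →
    HasCompactSupport (Function.uncurry φ) →
    tsupport (Function.uncurry φ) ⊆ univ ×ˢ Ioo 0 T →
    ∫ t in Ioo 0 T, ∫ x : ℝ,
      (u x t * deriv (fun s => φ x s) t
        + u x t ^ m * iteratedDeriv 2 (fun y => φ y t) x
        + |x| ^ σ * u x t * φ x t) = 0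

/-- The blow up set of `u` at time `T`: the points `x` for which there are `(x_k, t_k)` in
`ℝ × (0, T)` with `t_k → T`, `x_k → x` and `|u(x_k, t_k)| → ∞`. -/
def blowUpSet (T : ℝ) (u : ℝ → ℝ → ℝ) : Set ℝ :=
  {x | ∃ xs ts : ℕ → ℝ, (∀ k, ts k ∈ Ioo 0 T) ∧ Tendsto ts atTop (𝓝 T) ∧
    Tendsto xs atTop (𝓝 x) ∧ Tendsto (fun k => |u (xs k) (ts k)|) atTop atTop}

/-- `u` blows up globally at time `T`: `u(t)` is bounded for every `t ∈ [0, T)`, and the blow up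
set at time `T` is the whole line. -/
def BlowsUpGlobally (T : ℝ) (u : ℝ → ℝ → ℝ) : Prop :=
  (∀ t ∈ Ico 0 T, ∃ C, ∀ x, |u x t| ≤ C) ∧ blowUpSet T u = univ

end WeightedReaction

namespace WeightedReaction

/-! The flux `(f^m)' + β ξ f` has derivative `(α + β - ξ^σ) f` and vanishes at the origin for a good
profile and at every positive zero. A maximum argument shows that a profile is zero to the right of
any positive zero, so with an interface at `ξ₁` it is positive exactly up to `ξ₁`.

Suppose `f(0) = 0`. Critical points are minima only where `ξ^σ ≤ α` and maxima only where `ξ^σ ≥ α`,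
so `f` rises to a peak `ξₘ` and then falls. The first moment of the equation gives `ξ₁^σ = α + β +
n` with `n > β` (`lt_interface_rpow`). For small `σ` the function `ξ^σ` is almost constant on `[δ
ξ₁, ξ₁]`, with `δ` depending only on `m`, and still exceeds `α + β + n/2` there. If the peak lies
left of `δ ξ₁`, then `f^(m-1)` is at least a multiple of `β² ξ₁² / n` near the interface and at most
a multiple of `β² ξ₁ s / n` at `s = δ ξ₁`, which is absurd for this `δ` (`le_of_antitoneOn`). If the
peak lies to the right, the zero integral of `(α + β - ξ^σ) f` contradicts the monotonicity of `f`
up to the peak (`peak_rpow_le`). Hence `f(0) > 0`.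

For the weak formulation, the substitution `x = ξ (T - t)^(-β)` turns the space integral at each
time into the time derivative of `∫ u φ dx`, because the even extension of `f` satisfies the profile
equation weakly on the line (`integral_test`). Global blow-up follows since `|x| (T - t)^β → 0` for
every fixed `x`, where `f` is near `f(0) > 0`. -/

theorem alpha_pos {m σ : ℝ} (hm : 1 < m) (hσ : 0 < σ) : 0 < alpha m σ := by
  unfold alpha
  have : 0 < m - 1 := by linarith
  positivity

theorem beta_pos {σ : ℝ} (hσ : 0 < σ) : 0 < beta σ := by
  unfold beta
  positivity

/-- A function which does not exceed its value at `x` on the left of `x` has a nonnegative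
derivative at `x`. -/
theorem deriv_nonneg_of_le_left {g : ℝ → ℝ} {g' x : ℝ} (h : HasDerivAt g g' x)
    (hle : ∀ᶠ y in 𝓝[<] x, g y ≤ g x) : 0 ≤ g' := by
  have h1 : Tendsto (slope g x) (𝓝[<] x) (𝓝 g') :=
    (hasDerivAt_iff_tendsto_slope.1 h).mono_left
      (nhdsWithin_mono _ fun y hy => ne_of_lt hy)
  refine ge_of_tendsto h1 ?_
  filter_upwards [hle, self_mem_nhdsWithin] with y hy hyx
  rw [slope_def_field]
  exact div_nonneg_of_nonpos (by linarith) (by have : y < x := hyx; linarith)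

/-- A function which does not exceed its value at `x` on the right of `x` has a nonpositive
derivative at `x`. -/
theorem deriv_nonpos_of_le_right {g : ℝ → ℝ} {g' x : ℝ} (h : HasDerivAt g g' x)
    (hle : ∀ᶠ y in 𝓝[>] x, g y ≤ g x) : g' ≤ 0 := by
  have h1 : Tendsto (slope g x) (𝓝[>] x) (𝓝 g') :=
    (hasDerivAt_iff_tendsto_slope.1 h).mono_left
      (nhdsWithin_mono _ fun y hy => ne_of_gt hy)
  refine le_of_tendsto h1 ?_
  filter_upwards [hle, self_mem_nhdsWithin] with y hy hyx
  rw [slope_def_field]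
  exact div_nonpos_of_nonpos_of_nonneg (by linarith) (by have : x < y := hyx; linarith)

/-! ### Flux and vanishing beyond a zero -/

/-- The derivative of `f^m` on `[0, ∞)`, one-sided at the origin. -/
noncomputable def powDeriv (m : ℝ) (f : ℝ → ℝ) (ξ : ℝ) : ℝ :=
  derivWithin (fun s => f s ^ m) (Ici 0) ξ

/-- The flux `(f^m)' + β ξ f`. -/
noncomputable def flux (m σ : ℝ) (f : ℝ → ℝ) (ξ : ℝ) : ℝ :=
  powDeriv m f ξ + beta σ * ξ * f ξ

namespace IsProfile

variable {m σ : ℝ} {f : ℝ → ℝ}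

theorem hasDerivWithinAt_pow (hf : IsProfile m σ f) {ξ : ℝ} (hξ : 0 ≤ ξ) :
    HasDerivWithinAt (fun s => f s ^ m) (powDeriv m f ξ) (Ici 0) ξ :=
  (hf.pow_contDiffOn.differentiableOn one_ne_zero ξ hξ).hasDerivWithinAt

theorem hasDerivAt_pow (hf : IsProfile m σ f) {ξ : ℝ} (hξ : 0 < ξ) :
    HasDerivAt (fun s => f s ^ m) (powDeriv m f ξ) ξ :=
  (hf.hasDerivWithinAt_pow hξ.le).hasDerivAt (Ici_mem_nhds hξ)

theorem continuousOn_powDeriv (hf : IsProfile m σ f) : ContinuousOn (powDeriv m f) (Ici 0) :=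
  hf.pow_contDiffOn.continuousOn_derivWithin (uniqueDiffOn_Ici 0) le_rfl

theorem continuousOn_pow (hf : IsProfile m σ f) : ContinuousOn (fun s => f s ^ m) (Ici 0) :=
  hf.pow_contDiffOn.continuousOn

theorem continuousOn_flux (hf : IsProfile m σ f) : ContinuousOn (flux m σ f) (Ici 0) :=
  hf.continuousOn_powDeriv.add ((by fun_prop : Continuous fun ξ => beta σ * ξ).continuousOn.mul
    hf.continuousOn)

theorem hasDerivAt_flux (hf : IsProfile m σ f) {ξ : ℝ} (hξ : 0 < ξ) :
    HasDerivAt (flux m σ f) ((alpha m σ + beta σ - ξ ^ σ) * f ξ) ξ := by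
  refine (hf.equation ξ hξ).congr_of_eventuallyEq ?_
  filter_upwards [Ioi_mem_nhds hξ] with s hs
  simp only [flux, (hf.hasDerivAt_pow hs).deriv]

theorem continuousOn_reaction (hf : IsProfile m σ f) (hσ : 0 < σ) :
    ContinuousOn (fun ξ => (alpha m σ + beta σ - ξ ^ σ) * f ξ) (Ici 0) :=
  (continuous_const.sub (Real.continuous_rpow_const hσ.le)).continuousOn.mul hf.continuousOn

/-- An interior zero is a minimum of the nonnegative function `f^m`. -/
theorem powDeriv_eq_zero (hf : IsProfile m σ f) (hm : 1 < m) {a : ℝ} (ha : 0 < a)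
    (h0 : f a = 0) : powDeriv m f a = 0 := by
  have hmin : IsLocalMin (fun s => f s ^ m) a := by
    filter_upwards [Ioi_mem_nhds ha] with s hs
    rw [h0, Real.zero_rpow (by linarith)]
    exact Real.rpow_nonneg (hf.nonneg s (le_of_lt hs)) m
  exact hmin.hasDerivAt_eq_zero (hf.hasDerivAt_pow ha)

theorem flux_eq_zero (hf : IsProfile m σ f) (hm : 1 < m) {a : ℝ} (ha : 0 < a)
    (h0 : f a = 0) : flux m σ f a = 0 := by
  simp [flux, hf.powDeriv_eq_zero hm ha h0, h0]

theorem integral_reaction (hf : IsProfile m σ f) (hσ : 0 < σ) {a b : ℝ} (ha : 0 ≤ a)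
    (hab : a ≤ b) :
    ∫ ξ in a..b, (alpha m σ + beta σ - ξ ^ σ) * f ξ = flux m σ f b - flux m σ f a := by
  have hsub : Icc a b ⊆ Ici 0 := fun x hx => ha.trans hx.1
  refine intervalIntegral.integral_eq_sub_of_hasDerivAt_of_le hab
    (hf.continuousOn_flux.mono hsub) (fun x hx => hf.hasDerivAt_flux (ha.trans_lt hx.1)) ?_
  exact ((hf.continuousOn_reaction hσ).mono hsub).intervalIntegrable_of_Icc hab

/-- A profile stays zero for a fixed distance past a zero. -/
theorem eq_zero_near (hf : IsProfile m σ f) (hm : 1 < m) (hσ : 0 < σ) {a b ε : ℝ} (ha : 0 < a)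
    (hab : a ≤ b) (hε : 0 < ε) (hεa : ε * (alpha m σ + beta σ) < beta σ * a) (h0 : f b = 0) :
    ∀ ξ ∈ Icc b (b + ε), f ξ = 0 := by
  have hb : 0 < b := ha.trans_le hab
  have hα := alpha_pos hm hσ
  have hβ := beta_pos hσ
  have hsub : Icc b (b + ε) ⊆ Ici 0 := fun x hx => hb.le.trans hx.1
  obtain ⟨c, hc, hmax⟩ := isCompact_Icc.exists_isMaxOn (nonempty_Icc.2 (by linarith))
    (hf.continuousOn.mono hsub)
  suffices hfc : f c ≤ 0 from fun ξ hξ =>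
    le_antisymm ((hmax hξ).trans hfc) (hf.nonneg ξ (hsub hξ))
  by_contra! hpos
  have hbc : b < c := lt_of_le_of_ne hc.1 (by rintro rfl; linarith)
  -- Only the left side is compared, since the maximum `c` may be the endpoint `b + ε`.
  have hd : 0 ≤ powDeriv m f c := by
    refine deriv_nonneg_of_le_left (hf.hasDerivAt_pow (hb.trans hbc)) ?_
    filter_upwards [Ioo_mem_nhdsLT hbc] with y hy
    have hy' : y ∈ Icc b (b + ε) := ⟨hy.1.le, hy.2.le.trans hc.2⟩
    exact Real.rpow_le_rpow (hf.nonneg y (hsub hy')) (hmax hy') (by linarith)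
  have hint := hf.integral_reaction hσ hb.le hc.1
  rw [hf.flux_eq_zero hm hb h0, sub_zero] at hint
  -- The flux at `c` is at least `β c f(c)`, yet it is an integral over a length at most `ε`, hence
  -- at most `ε (α + β) f(c)`. The choice of `ε` makes these incompatible.
  have hle : ∫ ξ in b..c, (alpha m σ + beta σ - ξ ^ σ) * f ξ
      ≤ ∫ ξ in b..c, (alpha m σ + beta σ) * f c := by
    have hsub' : Icc b c ⊆ Ici 0 := fun x hx => hb.le.trans hx.1
    refine intervalIntegral.integral_mono_on hc.1
      (((hf.continuousOn_reaction hσ).mono hsub').intervalIntegrable_of_Icc hc.1)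
      (by simp) fun x hx => ?_
    have hx0 : 0 ≤ x := hsub' hx
    have h1 : 0 ≤ x ^ σ := Real.rpow_nonneg hx0 σ
    have h2 : f x ≤ f c := hmax ⟨hx.1, hx.2.trans hc.2⟩
    have h3 := hf.nonneg x hx0
    nlinarith [mul_nonneg h1 h3, mul_nonneg (add_pos hα hβ).le (sub_nonneg.2 h2)]
  rw [intervalIntegral.integral_const, hint, smul_eq_mul, flux] at hle
  have h4 : (c - b) * ((alpha m σ + beta σ) * f c) ≤ ε * ((alpha m σ + beta σ) * f c) :=
    mul_le_mul_of_nonneg_right (by linarith [hc.2]) (by positivity)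
  have h5 : beta σ * a * f c ≤ beta σ * c * f c := by gcongr; linarith
  nlinarith [mul_lt_mul_of_pos_right hεa hpos]

/-- A profile vanishes to the right of each of its positive zeros. -/
theorem eq_zero_of_le (hf : IsProfile m σ f) (hm : 1 < m) (hσ : 0 < σ) {a : ℝ} (ha : 0 < a)
    (h0 : f a = 0) {ξ : ℝ} (hξ : a ≤ ξ) : f ξ = 0 := by
  have hα := alpha_pos hm hσ
  have hβ := beta_pos hσ
  -- The step is chosen for `a` and works at every later zero, so finitely many steps reach any `ξ`.
  set ε := beta σ * a / (2 * (alpha m σ + beta σ)) with hεdef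
  have hε : 0 < ε := by positivity
  have hεa : ε * (alpha m σ + beta σ) < beta σ * a := by
    have : ε * (alpha m σ + beta σ) = beta σ * a / 2 := by rw [hεdef]; field_simp
    rw [this]
    linarith [mul_pos hβ ha]
  have key : ∀ n : ℕ, ∀ ξ ∈ Icc a (a + n * ε), f ξ = 0 := by
    intro n
    induction n with
    | zero => intro ξ hξ; simp at hξ; rw [hξ]; exact h0
    | succ k ih =>
      intro ξ hξ
      have hk : 0 ≤ k * ε := by positivity
      rcases le_total ξ (a + k * ε) with h | h
      · exact ih ξ ⟨hξ.1, h⟩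
      · refine hf.eq_zero_near hm hσ ha (by linarith) hε hεa
          (ih _ ⟨by linarith, le_rfl⟩) ξ ⟨h, ?_⟩
        have := hξ.2
        push_cast at this
        linarith
  obtain ⟨n, hn⟩ := exists_nat_gt ((ξ - a) / ε)
  rw [div_lt_iff₀ hε] at hn
  exact key n ξ ⟨hξ, by linarith⟩

end IsProfile

theorem IsGoodProfile.powDeriv_zero {m σ : ℝ} {f : ℝ → ℝ} (hf : IsGoodProfile m σ f) :
    powDeriv m f 0 = 0 := by
  have hu : UniqueDiffWithinAt ℝ (Ici (0 : ℝ)) 0 := uniqueDiffOn_Ici 0 0 (mem_Ici.2 le_rfl)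
  rcases hf.2 with ⟨hpos, hd⟩ | ⟨_, hd⟩
  · have := hd.rpow_const (p := m) (Or.inl hpos.ne')
    simpa [powDeriv] using this.derivWithin hu
  · exact hd.derivWithin hu

theorem IsGoodProfile.flux_zero {m σ : ℝ} {f : ℝ → ℝ} (hf : IsGoodProfile m σ f) :
    flux m σ f 0 = 0 := by
  simp [flux, hf.powDeriv_zero]

/-- A profile with interface is positive on `(0, ξ₁)` and zero on `[ξ₁, ∞)`. -/
theorem IsGoodProfileWithInterface.exists_support {m σ : ℝ} {f : ℝ → ℝ} (hm : 1 < m) (hσ : 0 < σ)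
    (hf : IsGoodProfileWithInterface m σ f) :
    ∃ ξ₁ > 0, (∀ ξ ∈ Ioo 0 ξ₁, 0 < f ξ) ∧ ∀ ξ, ξ₁ ≤ ξ → f ξ = 0 := by
  obtain ⟨⟨hp, -⟩, ξ₁, hξ₁, h0, -, δ, hδ, hpos⟩ := hf
  refine ⟨ξ₁, hξ₁, fun ξ hξ => ?_, fun ξ hξ => hp.eq_zero_of_le hm hσ hξ₁ h0 hξ⟩
  by_contra! hle
  have hz : f ξ = 0 := le_antisymm hle (hp.nonneg ξ hξ.1.le)
  have hlt : max ξ (ξ₁ - δ) < ξ₁ := max_lt hξ.2 (by linarith)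
  obtain ⟨y, hy1, hy2⟩ := exists_between hlt
  have h1 := hpos y ⟨(le_max_right _ _).trans_lt hy1, hy2⟩
  have h2 := hp.eq_zero_of_le hm hσ hξ.1 hz ((le_max_left _ _).trans hy1.le)
  linarith

/-! ### Critical points and the single peak -/

/-- The second derivative test, as a necessary condition. -/
theorem second_deriv_nonneg_of_isLocalMin {g : ℝ → ℝ} {c : ℝ} (hg : ContinuousAt g c)
    (h : IsLocalMin g c) : 0 ≤ deriv (deriv g) c := by
  by_contra! hneg
  -- A negative second derivative would make `c` a maximum as well, so `g` would be locally
  -- constant.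
  have hmax := isLocalMax_of_deriv_deriv_neg hneg h.deriv_eq_zero hg
  have hconst : g =ᶠ[𝓝 c] fun _ => g c := by
    filter_upwards [h, hmax] with y h1 h2 using le_antisymm h2 h1
  have h0 : deriv g =ᶠ[𝓝 c] fun _ => 0 := by
    simpa using hconst.deriv
  have := h0.deriv_eq
  simp at this
  linarith

namespace IsProfile

variable {m σ : ℝ} {f : ℝ → ℝ}

/-- Powers of a profile are differentiable where it is positive. -/
theorem hasDerivAt_rpow (hf : IsProfile m σ f) (hm : 1 < m) {ξ : ℝ} (hξ : 0 < ξ) (hpos : 0 < f ξ)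
    (q : ℝ) :
    HasDerivAt (fun s => f s ^ q) (q / m * f ξ ^ (q - m) * powDeriv m f ξ) ξ := by
  have hm0 : m ≠ 0 := by linarith
  -- Only `f^m` is known to be differentiable, so `f^q` is written as `(f^m)^(q/m)`.
  have h := (hf.hasDerivAt_pow hξ).rpow_const (p := q / m) (Or.inl (Real.rpow_pos_of_pos hpos m).ne')
  have he : (fun s => (f s ^ m) ^ (q / m)) =ᶠ[𝓝 ξ] fun s => f s ^ q := by
    filter_upwards [Ioi_mem_nhds hξ] with s hs
    rw [← Real.rpow_mul (hf.nonneg s (le_of_lt hs)), mul_div_cancel₀ q hm0]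
  refine (h.congr_of_eventuallyEq he.symm).congr_deriv ?_
  rw [← Real.rpow_mul hpos.le]
  have : m * (q / m - 1) = q - m := by field_simp
  rw [this]
  ring

/-- At a critical point `f' = 0`, so subtracting `β ξ f` from the flux removes exactly `β f` from
its derivative. -/
theorem hasDerivAt_powDeriv_of_critical (hf : IsProfile m σ f) (hm : 1 < m) {c : ℝ} (hc : 0 < c)
    (hpos : 0 < f c) (h0 : powDeriv m f c = 0) :
    HasDerivAt (powDeriv m f) ((alpha m σ - c ^ σ) * f c) c := by
  have h1 : HasDerivAt f 0 c := by
    have := hf.hasDerivAt_rpow hm hc hpos 1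
    simpa [h0] using this
  have h2 := (hf.hasDerivAt_flux hc).sub (((hasDerivAt_id c).const_mul (beta σ)).mul h1)
  refine (h2.congr_of_eventuallyEq (Eventually.of_forall fun s => ?_)).congr_deriv ?_
  · simp [flux]
  · simp
    ring

theorem rpow_le_alpha_of_isLocalMin (hf : IsProfile m σ f) (hm : 1 < m) {c : ℝ} (hc : 0 < c)
    (hpos : 0 < f c) (hmin : IsLocalMin f c) : c ^ σ ≤ alpha m σ := by
  have hmin' : IsLocalMin (fun s => f s ^ m) c := by
    filter_upwards [hmin] with s hs using Real.rpow_le_rpow hpos.le hs (by linarith)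
  have hd := hf.hasDerivAt_pow hc
  have h2 := hf.hasDerivAt_powDeriv_of_critical hm hc hpos (hmin'.hasDerivAt_eq_zero hd)
  have he : deriv (fun s => f s ^ m) =ᶠ[𝓝 c] powDeriv m f := by
    filter_upwards [Ioi_mem_nhds hc] with s hs using (hf.hasDerivAt_pow hs).deriv
  have h3 := second_deriv_nonneg_of_isLocalMin hd.continuousAt hmin'
  rw [he.deriv_eq, h2.deriv] at h3
  nlinarith

theorem alpha_le_rpow_of_isLocalMax (hf : IsProfile m σ f) (hm : 1 < m) {c : ℝ} (hc : 0 < c)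
    (hpos : 0 < f c) (hmax : IsLocalMax f c) : alpha m σ ≤ c ^ σ := by
  have hmax' : IsLocalMax (fun s => f s ^ m) c := by
    filter_upwards [hmax, Ioi_mem_nhds hc] with s hs h0 using
      Real.rpow_le_rpow (hf.nonneg s (le_of_lt h0)) hs (by linarith)
  have hd := hf.hasDerivAt_pow hc
  have h2 := hf.hasDerivAt_powDeriv_of_critical hm hc hpos (hmax'.hasDerivAt_eq_zero hd)
  have he : deriv (fun s => -f s ^ m) =ᶠ[𝓝 c] fun s => -powDeriv m f s := by
    filter_upwards [Ioi_mem_nhds hc] with s hs using (hf.hasDerivAt_pow hs).neg.deriv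
  have h3 := second_deriv_nonneg_of_isLocalMin hd.neg.continuousAt hmax'.neg
  have h4 : 0 ≤ -((alpha m σ - c ^ σ) * f c) := by
    rw [← h2.neg.deriv]
    refine h3.trans_eq ?_
    exact he.deriv_eq
  nlinarith

/-- Otherwise the maximum over `[0, t]` is interior, at a point with `c^σ < t^σ ≤ α`, where no
positive maximum can occur; `f(0) = 0` excludes the left endpoint. -/
theorem le_of_le_critical (hf : IsProfile m σ f) (hm : 1 < m) (hσ : 0 < σ) (h0 : f 0 = 0) {s t : ℝ}
    (hs : 0 ≤ s) (hst : s ≤ t) (ht : t ^ σ ≤ alpha m σ) : f s ≤ f t := by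
  by_contra! hlt
  have hsub : Icc 0 t ⊆ Ici 0 := fun x hx => hx.1
  obtain ⟨c, hc, hmax⟩ := isCompact_Icc.exists_isMaxOn (nonempty_Icc.2 (hs.trans hst))
    (hf.continuousOn.mono hsub)
  have hcs : f s ≤ f c := hmax ⟨hs, hst⟩
  have ht0 := hf.nonneg t (hs.trans hst)
  have hct : c < t := lt_of_le_of_ne hc.2 (by rintro rfl; linarith)
  have hc0 : 0 < c := lt_of_le_of_ne hc.1 (by rintro rfl; linarith)
  have := hf.alpha_le_rpow_of_isLocalMax hm hc0 (by linarith)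
    (hmax.isLocalMax (Icc_mem_nhds hc0 hct))
  linarith [Real.rpow_lt_rpow hc0.le hct hσ]

/-- A dip below both ends would produce an interior minimum where `ξ^σ > α`. -/
theorem min_le_of_critical_le (hf : IsProfile m σ f) (hm : 1 < m) (hσ : 0 < σ) {s t u ξ₁ : ℝ}
    (hpos : ∀ ξ ∈ Ioo 0 ξ₁, 0 < f ξ) (hs0 : 0 < s) (hs : alpha m σ ≤ s ^ σ) (hst : s ≤ t)
    (htu : t ≤ u) (hu : u ≤ ξ₁) : min (f s) (f u) ≤ f t := by
  by_contra! hlt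
  rw [lt_min_iff] at hlt
  have hsub : Icc s u ⊆ Ici 0 := fun x hx => hs0.le.trans hx.1
  obtain ⟨c, hc, hmin⟩ := isCompact_Icc.exists_isMinOn (nonempty_Icc.2 (hst.trans htu))
    (hf.continuousOn.mono hsub)
  have hct : f c ≤ f t := hmin ⟨hst, htu⟩
  have hsc : s < c := lt_of_le_of_ne hc.1 (by rintro rfl; linarith [hlt.1])
  have hcu : c < u := lt_of_le_of_ne hc.2 (by rintro rfl; linarith [hlt.2])
  have := hf.rpow_le_alpha_of_isLocalMin hm (hs0.trans hsc)
    (hpos c ⟨hs0.trans hsc, hcu.trans_le hu⟩) (hmin.isLocalMin (Icc_mem_nhds hsc hcu))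
  linarith [Real.rpow_lt_rpow hs0.le hsc hσ]

/-- A profile which vanishes at the origin first increases and then decreases. -/
theorem exists_monotoneOn_antitoneOn (hf : IsProfile m σ f) (hm : 1 < m) (hσ : 0 < σ)
    (h0 : f 0 = 0) {ξ₁ : ℝ} (hξ₁ : 0 < ξ₁) (hpos : ∀ ξ ∈ Ioo 0 ξ₁, 0 < f ξ) (h1 : f ξ₁ = 0) :
    ∃ ξₘ ∈ Ioo 0 ξ₁, MonotoneOn f (Icc 0 ξₘ) ∧ AntitoneOn f (Icc ξₘ ξ₁) := by
  have hα := alpha_pos hm hσ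
  have hsub : Icc 0 ξ₁ ⊆ Ici 0 := fun x hx => hx.1
  obtain ⟨c, hc, hmax⟩ := isCompact_Icc.exists_isMaxOn (nonempty_Icc.2 hξ₁.le)
    (hf.continuousOn.mono hsub)
  have hfc : 0 < f c := (hpos (ξ₁ / 2) ⟨by linarith, by linarith⟩).trans_le
    (hmax ⟨by linarith, by linarith⟩)
  have hc0 : 0 < c := lt_of_le_of_ne hc.1 (by rintro rfl; linarith)
  have hc1 : c < ξ₁ := lt_of_le_of_ne hc.2 (by rintro rfl; linarith)
  have hcα := hf.alpha_le_rpow_of_isLocalMax hm hc0 hfc (hmax.isLocalMax (Icc_mem_nhds hc0 hc1))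
  refine ⟨c, ⟨hc0, hc1⟩, fun s hs t ht hst => ?_, fun s hs t ht hst => ?_⟩
  · set k := alpha m σ ^ σ⁻¹ with hk
    have hk0 : 0 < k := Real.rpow_pos_of_pos hα _
    have hkσ : k ^ σ = alpha m σ := Real.rpow_inv_rpow hα.le hσ.ne'
    rcases le_total t k with htk | htk
    · exact hf.le_of_le_critical hm hσ h0 hs.1 hst
        ((Real.rpow_le_rpow ht.1 htk hσ.le).trans_eq hkσ)
    -- The threshold `k`, with `k^σ = α`, splits the way from `s` to the peak: below it no maximum
    -- is possible, above it no minimum.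
    · have h2 : f s ≤ f (max s k) := by
        rcases le_total s k with h | h
        · rw [max_eq_right h]
          exact hf.le_of_le_critical hm hσ h0 hs.1 h hkσ.le
        · rw [max_eq_left h]
      have h3 := hf.min_le_of_critical_le hm hσ hpos (hk0.trans_le (le_max_right s k))
        (hkσ.symm.le.trans (Real.rpow_le_rpow hk0.le (le_max_right s k) hσ.le))
        (max_le hst htk) ht.2 hc1.le
      rw [min_eq_left (hmax ⟨hs.1.trans (le_max_left _ _), (max_le hst htk).trans
        (ht.2.trans hc1.le)⟩)] at h3
      exact h2.trans h3
  · have h3 := hf.min_le_of_critical_le hm hσ hpos hc0 hcα hs.1 hst ht.2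
    rwa [min_eq_right (hmax ⟨hc0.le.trans ht.1, ht.2⟩)] at h3

/-! ### Moment identity and size of a decreasing profile -/

/-- The integrand is the derivative of `flux(t) (t - s) - f(t)^m`, the equation multiplied by `t -
s` and integrated by parts. The base point `0` locates the interface; a positive one bounds `f(s)^m`
by the mass to its right. -/
theorem integral_moment (hf : IsProfile m σ f) (hm : 1 < m) (hσ : 0 < σ) {s ξ₁ : ℝ} (hs : 0 ≤ s)
    (hs1 : s ≤ ξ₁) (hξ₁ : 0 < ξ₁) (h1 : f ξ₁ = 0) :
    ∫ t in s..ξ₁, ((alpha m σ + 2 * beta σ - t ^ σ) * (t - s) + beta σ * s) * f t = f s ^ m := by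
  have hsub : Icc s ξ₁ ⊆ Ici 0 := fun x hx => hs.trans hx.1
  have key : ∫ t in s..ξ₁, ((alpha m σ + 2 * beta σ - t ^ σ) * (t - s) + beta σ * s) * f t
      = (flux m σ f ξ₁ * (ξ₁ - s) - f ξ₁ ^ m) - (flux m σ f s * (s - s) - f s ^ m) := by
    refine intervalIntegral.integral_eq_sub_of_hasDerivAt_of_le
      (f := fun t => flux m σ f t * (t - s) - f t ^ m) hs1 ?_ (fun t ht => ?_) ?_
    · exact ((hf.continuousOn_flux.mono hsub).mul (by fun_prop)).sub
        (hf.continuousOn_pow.mono hsub)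
    · have ht0 : 0 < t := hs.trans_lt ht.1
      refine (((hf.hasDerivAt_flux ht0).mul ((hasDerivAt_id t).sub_const s)).sub
        (hf.hasDerivAt_pow ht0)).congr_deriv ?_
      simp [flux]
      ring
    · refine ContinuousOn.intervalIntegrable_of_Icc hs1 (ContinuousOn.mul ?_
        (hf.continuousOn.mono hsub))
      exact (((continuous_const.sub (Real.continuous_rpow_const hσ.le)).mul
        (by fun_prop)).add continuous_const).continuousOn
  rw [key, hf.flux_eq_zero hm hξ₁ h1, h1, Real.zero_rpow (by linarith)]
  ring

/-- The interface of a profile starting from zero is far away. -/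
theorem lt_interface_rpow (hf : IsProfile m σ f) (hm : 1 < m) (hσ : 0 < σ) (h0 : f 0 = 0)
    {ξ₁ : ℝ} (hξ₁ : 0 < ξ₁) (hpos : ∀ ξ ∈ Ioo 0 ξ₁, 0 < f ξ) (h1 : f ξ₁ = 0) :
    alpha m σ + 2 * beta σ < ξ₁ ^ σ := by
  by_contra! hle
  have hint := hf.integral_moment hm hσ le_rfl hξ₁.le hξ₁ h1
  rw [h0, Real.zero_rpow (by linarith)] at hint
  have hcont : ContinuousOn
      (fun t => ((alpha m σ + 2 * beta σ - t ^ σ) * (t - 0) + beta σ * 0) * f t) (Icc 0 ξ₁) :=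
    ContinuousOn.mul (((continuous_const.sub (Real.continuous_rpow_const hσ.le)).mul
        (by fun_prop)).add continuous_const).continuousOn
      (hf.continuousOn.mono fun x hx => hx.1)
  have := intervalIntegral.intervalIntegral_pos_of_pos_on
    (hcont.intervalIntegrable_of_Icc hξ₁.le) (fun t ht => ?_) hξ₁
  · linarith
  · have h2 : t ^ σ < ξ₁ ^ σ := Real.rpow_lt_rpow ht.1.le ht.2 hσ
    have h3 := hpos t ht
    have h4 : 0 < alpha m σ + 2 * beta σ - t ^ σ := by linarith
    have h5 := ht.1
    simp only [sub_zero, mul_zero, add_zero]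
    positivity

/-- Near the interface a decreasing profile is at least of the size of a travelling wave. -/
theorem lower_bound_near_interface (hf : IsProfile m σ f) (hm : 1 < m) (hσ : 0 < σ)
    {ξ₁ n s : ℝ} (hξ₁ : 0 < ξ₁) (hpos : ∀ ξ ∈ Ioo 0 ξ₁, 0 < f ξ) (h1 : f ξ₁ = 0)
    (hn : beta σ ≤ n) (hn1 : ξ₁ ^ σ = alpha m σ + beta σ + n)
    (hs : s = ξ₁ * (1 - beta σ / (4 * n))) (hanti : AntitoneOn f (Icc s ξ₁)) :
    (m - 1) / (8 * m) * (beta σ ^ 2 * ξ₁ ^ 2 / n) ≤ f s ^ (m - 1) := by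
  have hβ := beta_pos hσ
  have hn0 : 0 < n := hβ.trans_le hn
  have hm0 : 0 < m := by linarith
  -- On a layer of width `r ξ₁` the reaction contributes at most `β ξ₁ f / 4` to the flux, while `β
  -- t f ≥ 3 β ξ₁ f / 4`; the difference is the slope bound below.
  set r := beta σ / (4 * n) with hr
  have hr0 : 0 < r := by positivity
  have hr1 : r ≤ 1 / 4 := by
    rw [hr, div_le_iff₀ (by positivity)]
    linarith
  have hnr : n * r = beta σ / 4 := by rw [hr]; field_simp
  have hs0 : 0 < s := by rw [hs]; exact mul_pos hξ₁ (by linarith)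
  have hs1 : s < ξ₁ := by rw [hs]; nlinarith
  have hslope : ∀ t ∈ Ioo s ξ₁, powDeriv m f t ≤ -(beta σ * ξ₁ / 2) * f t := by
    intro t ht
    have ht0 : 0 < t := hs0.trans ht.1
    have hft := hpos t ⟨ht0, ht.2⟩
    have hint := hf.integral_reaction hσ ht0.le ht.2.le
    rw [hf.flux_eq_zero hm hξ₁ h1] at hint
    have hsub' : Icc t ξ₁ ⊆ Ici 0 := fun x hx => ht0.le.trans hx.1
    have hge : ∫ x in t..ξ₁, (-n * f t) ≤ ∫ x in t..ξ₁, (alpha m σ + beta σ - x ^ σ) * f x := by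
      refine intervalIntegral.integral_mono_on ht.2.le (by simp)
        (((hf.continuousOn_reaction hσ).mono hsub').intervalIntegrable_of_Icc ht.2.le)
        fun x hx => ?_
      have h3 : x ^ σ ≤ ξ₁ ^ σ := Real.rpow_le_rpow (hsub' hx) hx.2 hσ.le
      have h4 : f x ≤ f t := hanti ⟨ht.1.le, ht.2.le⟩ ⟨ht.1.le.trans hx.1, hx.2⟩ hx.1
      have h5 := hf.nonneg x (hsub' hx)
      nlinarith
    rw [intervalIntegral.integral_const, hint, smul_eq_mul, flux] at hge
    have h6 : n * (ξ₁ - t) ≤ beta σ * ξ₁ / 4 := by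
      have : ξ₁ - t ≤ ξ₁ * r := by
        have := ht.1
        rw [hs] at this
        linarith
      nlinarith
    have h7 : beta σ * (ξ₁ * (3 / 4)) ≤ beta σ * t := by
      refine mul_le_mul_of_nonneg_left ?_ hβ.le
      have := ht.1
      rw [hs] at this
      nlinarith
    nlinarith
  have hcont : ContinuousOn (fun t => f t ^ (m - 1)) (Icc s ξ₁) :=
    (hf.continuousOn.mono fun x hx => hs0.le.trans hx.1).rpow_const fun x _ => Or.inr (by linarith)
  have hderiv : ∀ t ∈ Ioo s ξ₁, HasDerivAt (fun t => f t ^ (m - 1))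
      ((m - 1) / m * f t ^ ((m - 1) - m) * powDeriv m f t) t := fun t ht =>
    hf.hasDerivAt_rpow hm (hs0.trans ht.1) (hpos t ⟨hs0.trans ht.1, ht.2⟩) (m - 1)
  -- Since `(f^(m-1))' = (m-1)/m · (f^m)'/f`, the slope bound becomes a constant one, which is
  -- integrated over the layer.
  have hmvt := Convex.image_sub_le_mul_sub_of_deriv_le (convex_Icc s ξ₁) hcont
    (C := -((m - 1) / m * (beta σ * ξ₁ / 2)))
    (fun t ht => by
      rw [interior_Icc] at ht
      exact (hderiv t ht).differentiableAt.differentiableWithinAt)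
    (fun t ht => by
      rw [interior_Icc] at ht
      rw [(hderiv t ht).deriv]
      have hft := hpos t ⟨hs0.trans ht.1, ht.2⟩
      have h8 : (m - 1) - m = (-1 : ℝ) := by ring
      rw [h8, Real.rpow_neg_one]
      have h9 : powDeriv m f t / f t ≤ -(beta σ * ξ₁ / 2) := by
        rw [div_le_iff₀ hft]
        exact hslope t ht
      calc (m - 1) / m * (f t)⁻¹ * powDeriv m f t = (m - 1) / m * (powDeriv m f t / f t) := by
            field_simp
        _ ≤ (m - 1) / m * -(beta σ * ξ₁ / 2) :=
            mul_le_mul_of_nonneg_left h9 (div_nonneg (by linarith) hm0.le)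
        _ = _ := by ring)
    s ⟨le_rfl, hs1.le⟩ ξ₁ ⟨hs1.le, le_rfl⟩ hs1.le
  rw [h1, Real.zero_rpow (by linarith)] at hmvt
  have h10 : ξ₁ - s = ξ₁ * r := by rw [hs]; ring
  rw [h10] at hmvt
  have h11 : (m - 1) / (8 * m) * (beta σ ^ 2 * ξ₁ ^ 2 / n)
      = (m - 1) / m * (beta σ * ξ₁ / 2) * (ξ₁ * r) := by
    rw [hr]
    field_simp
    ring
  rw [h11]
  linarith

/-- Where a profile decreases up to a far interface, it is at most of parabolic size. -/
theorem upper_bound_of_antitoneOn (hf : IsProfile m σ f) (hm : 1 < m) (hσ : 0 < σ)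
    {ξ₁ n s : ℝ} (hξ₁ : 0 < ξ₁) (hpos : ∀ ξ ∈ Ioo 0 ξ₁, 0 < f ξ) (h1 : f ξ₁ = 0)
    (hn : beta σ ≤ n) (hs0 : 0 < s) (hs1 : s < ξ₁)
    (hE : ∀ t ∈ Icc s ξ₁, alpha m σ + beta σ + n / 2 ≤ t ^ σ)
    (hanti : AntitoneOn f (Icc s ξ₁)) :
    f s ^ (m - 1) ≤ 3 * (beta σ ^ 2 * ξ₁ * s / n) := by
  have hβ := beta_pos hσ
  have hn0 : 0 < n := hβ.trans_le hn
  have hfs := hpos s ⟨hs0, hs1⟩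
  have hsub : Icc s ξ₁ ⊆ Ici 0 := fun x hx => hs0.le.trans hx.1
  have hfi : IntervalIntegrable f MeasureTheory.volume s ξ₁ :=
    (hf.continuousOn.mono hsub).intervalIntegrable_of_Icc hs1.le
  have hd : powDeriv m f s ≤ 0 := by
    refine deriv_nonpos_of_le_right (hf.hasDerivAt_pow hs0) ?_
    filter_upwards [Ioo_mem_nhdsGT hs1] with y hy
    exact Real.rpow_le_rpow (hf.nonneg y (hs0.le.trans hy.1.le))
      (hanti ⟨le_rfl, hs1.le⟩ ⟨hy.1.le, hy.2.le⟩ hy.1.le) (by linarith)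
  -- The reaction coefficient is at most `-n/2` here and `(f^m)'(s) ≤ 0`, so the flux `β s f(s)`
  -- dominates the mass to the right.
  have hmass : n / 2 * ∫ t in s..ξ₁, f t ≤ beta σ * s * f s := by
    have hint := hf.integral_reaction hσ hs0.le hs1.le
    rw [hf.flux_eq_zero hm hξ₁ h1] at hint
    have hle : ∫ x in s..ξ₁, (alpha m σ + beta σ - x ^ σ) * f x ≤ ∫ x in s..ξ₁, -(n / 2) * f x := by
      refine intervalIntegral.integral_mono_on hs1.le
        (((hf.continuousOn_reaction hσ).mono hsub).intervalIntegrable_of_Icc hs1.le)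
        (hfi.const_mul _) fun x hx => ?_
      exact mul_le_mul_of_nonneg_right (by linarith [hE x hx]) (hf.nonneg x (hsub hx))
    rw [intervalIntegral.integral_const_mul, hint, flux] at hle
    linarith
  -- The weight in the moment identity is at most `β/2 · (t - s) + β s`, as `n ≥ β`.
  have hpow : f s ^ m ≤ 3 / 2 * (beta σ * ξ₁) * ∫ t in s..ξ₁, f t := by
    rw [← hf.integral_moment hm hσ hs0.le hs1.le hξ₁ h1, ← intervalIntegral.integral_const_mul]
    refine intervalIntegral.integral_mono_on hs1.le ?_ (hfi.const_mul _) fun x hx => ?_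
    · refine ContinuousOn.intervalIntegrable_of_Icc hs1.le (ContinuousOn.mul ?_
        (hf.continuousOn.mono hsub))
      exact (((continuous_const.sub (Real.continuous_rpow_const hσ.le)).mul
        (by fun_prop)).add continuous_const).continuousOn
    · refine mul_le_mul_of_nonneg_right ?_ (hf.nonneg x (hsub hx))
      have h2 : alpha m σ + 2 * beta σ - x ^ σ ≤ beta σ / 2 := by linarith [hE x hx]
      have h3 : (alpha m σ + 2 * beta σ - x ^ σ) * (x - s) ≤ beta σ / 2 * (x - s) :=
        mul_le_mul_of_nonneg_right h2 (by linarith [hx.1])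
      nlinarith [hx.2]
  have h4 : f s ^ m = f s ^ (m - 1) * f s := by
    rw [← Real.rpow_add_one hfs.ne', sub_add_cancel]
  have h5 : f s ^ (m - 1) * f s ≤ 3 * (beta σ ^ 2 * ξ₁ * s / n) * f s := by
    rw [← h4]
    refine hpow.trans ?_
    have h6 : ∫ t in s..ξ₁, f t ≤ 2 * (beta σ * s * f s) / n := by
      rw [le_div_iff₀ hn0]
      linarith
    calc 3 / 2 * (beta σ * ξ₁) * ∫ t in s..ξ₁, f t
        ≤ 3 / 2 * (beta σ * ξ₁) * (2 * (beta σ * s * f s) / n) := by gcongr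
      _ = _ := by ring
  exact le_of_mul_le_mul_right h5 hfs

/-- A profile decreasing on `[s, ξ₁]` with `ξ₁` a far interface cannot have `s` small compared
with `ξ₁`. -/
theorem le_of_antitoneOn (hf : IsProfile m σ f) (hm : 1 < m) (hσ : 0 < σ)
    {ξ₁ n s : ℝ} (hξ₁ : 0 < ξ₁) (hpos : ∀ ξ ∈ Ioo 0 ξ₁, 0 < f ξ) (h1 : f ξ₁ = 0)
    (hn : beta σ ≤ n) (hn1 : ξ₁ ^ σ = alpha m σ + beta σ + n) (hs0 : 0 < s)
    (hs1 : s ≤ 3 / 4 * ξ₁) (hE : ∀ t ∈ Icc s ξ₁, alpha m σ + beta σ + n / 2 ≤ t ^ σ)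
    (hanti : AntitoneOn f (Icc s ξ₁)) : (m - 1) / (24 * m) * ξ₁ ≤ s := by
  have hβ := beta_pos hσ
  have hn0 : 0 < n := hβ.trans_le hn
  have hm0 : 0 < m := by linarith
  have hr1 : beta σ / (4 * n) ≤ 1 / 4 := by
    rw [div_le_iff₀ (by positivity)]
    linarith
  have hr0 : 0 < beta σ / (4 * n) := by positivity
  have hst : s ≤ ξ₁ * (1 - beta σ / (4 * n)) := by nlinarith
  have ht1 : ξ₁ * (1 - beta σ / (4 * n)) ≤ ξ₁ := by nlinarith
  have hlow := hf.lower_bound_near_interface hm hσ hξ₁ hpos h1 hn hn1 rfl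
    (hanti.mono (Icc_subset_Icc_left hst))
  have hup := hf.upper_bound_of_antitoneOn hm hσ hξ₁ hpos h1 hn hs0 (by linarith) hE hanti
  have hmid : f (ξ₁ * (1 - beta σ / (4 * n))) ^ (m - 1) ≤ f s ^ (m - 1) :=
    Real.rpow_le_rpow (hf.nonneg _ (hs0.le.trans hst))
      (hanti ⟨le_rfl, by linarith⟩ ⟨hst, ht1⟩ hst) (by linarith)
  have h2 := hlow.trans (hmid.trans hup)
  have h3 : (m - 1) / (8 * m) * (beta σ ^ 2 * ξ₁ ^ 2 / n)
      = 3 * (beta σ ^ 2 * ξ₁ / n) * ((m - 1) / (24 * m) * ξ₁) := by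
    field_simp
    ring
  have h4 : 3 * (beta σ ^ 2 * ξ₁ * s / n) = 3 * (beta σ ^ 2 * ξ₁ / n) * s := by ring
  rw [h3, h4] at h2
  exact le_of_mul_le_mul_left h2 (by positivity)

/-! ### Position of the peak and the contradiction -/

/-- A profile starting from zero, with vanishing flux at the origin, cannot keep increasing too
far. -/
theorem peak_rpow_le (hf : IsProfile m σ f) (hm : 1 < m) (hσ : 0 < σ)
    (hd0 : powDeriv m f 0 = 0) {ξ₁ ξₘ : ℝ} (hpos : ∀ ξ ∈ Ioo 0 ξ₁, 0 < f ξ) (h1 : f ξ₁ = 0)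
    (hξₘ : ξₘ ∈ Ioo 0 ξ₁) (hmono : MonotoneOn f (Icc 0 ξₘ)) :
    ξₘ ^ σ ≤ (1 + σ) * (alpha m σ + beta σ) := by
  by_contra! hlt
  have hα := alpha_pos hm hσ
  have hβ := beta_pos hσ
  have hξ₁ : 0 < ξ₁ := hξₘ.1.trans hξₘ.2
  set c := alpha m σ + beta σ with hc
  have hc0 : 0 < c := by positivity
  have hcm : c < ξₘ ^ σ := by nlinarith
  have hcont := hf.continuousOn_reaction hσ
  have hi1 : IntervalIntegrable (fun ξ => (c - ξ ^ σ) * f ξ) MeasureTheory.volume 0 ξₘ :=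
    (hcont.mono fun x hx => hx.1).intervalIntegrable_of_Icc hξₘ.1.le
  have hi2 : IntervalIntegrable (fun ξ => (c - ξ ^ σ) * f ξ) MeasureTheory.volume ξₘ ξ₁ :=
    (hcont.mono fun x hx => hξₘ.1.le.trans hx.1).intervalIntegrable_of_Icc hξₘ.2.le
  have htot := hf.integral_reaction hσ le_rfl hξ₁.le
  rw [hf.flux_eq_zero hm hξ₁ h1, flux, hd0,
    ← intervalIntegral.integral_add_adjacent_intervals hi1 hi2] at htot
  have hright : ∫ ξ in ξₘ..ξ₁, (c - ξ ^ σ) * f ξ ≤ 0 := by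
    refine (intervalIntegral.integral_mono_on (g := fun _ => (0 : ℝ)) hξₘ.2.le hi2 (by simp)
      fun x hx => ?_).trans_eq (by simp)
    have hx0 : 0 ≤ x := hξₘ.1.le.trans hx.1
    have := Real.rpow_le_rpow hξₘ.1.le hx.1 hσ.le
    exact mul_nonpos_of_nonpos_of_nonneg (by linarith) (hf.nonneg x hx0)
  set k := c ^ σ⁻¹ with hk
  have hk0 : 0 < k := Real.rpow_pos_of_pos hc0 _
  have hkσ : k ^ σ = c := Real.rpow_inv_rpow hc0.le hσ.ne'
  have hkm : k < ξₘ := by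
    by_contra! h
    linarith [Real.rpow_le_rpow hξₘ.1.le h hσ.le]
  have hfk := hpos k ⟨hk0, hkm.trans hξₘ.2⟩
  -- Chebyshev's trick: `c - ξ^σ` changes sign at `k` and `f` increases, so replacing `f(ξ)` by
  -- `f(k)` can only enlarge the integrand.
  have hleft : ∫ ξ in (0 : ℝ)..ξₘ, (c - ξ ^ σ) * f ξ ≤ ∫ ξ in (0 : ℝ)..ξₘ, (c - ξ ^ σ) * f k := by
    refine intervalIntegral.integral_mono_on hξₘ.1.le hi1 ?_ fun x hx => ?_
    · exact ((continuous_const.sub (Real.continuous_rpow_const hσ.le)).mul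
        continuous_const).intervalIntegrable _ _
    · rcases le_total x k with h | h
      · have h2 := Real.rpow_le_rpow hx.1 h hσ.le
        exact mul_le_mul_of_nonneg_left (hmono hx ⟨hk0.le, hkm.le⟩ h) (by linarith)
      · have h2 := Real.rpow_le_rpow hk0.le h hσ.le
        exact mul_le_mul_of_nonpos_left (hmono ⟨hk0.le, hkm.le⟩ hx h) (by linarith)
  rw [intervalIntegral.integral_mul_const, intervalIntegral.integral_sub (by simp)
    ((Real.continuous_rpow_const hσ.le).intervalIntegrable _ _), intervalIntegral.integral_const,
    integral_rpow (Or.inl (by linarith)), Real.zero_rpow (by linarith), smul_eq_mul, sub_zero,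
    sub_zero, Real.rpow_add_one hξₘ.1.ne'] at hleft
  have h3 : ξₘ * c - ξₘ ^ σ * ξₘ / (σ + 1) < 0 := by
    rw [sub_neg, lt_div_iff₀ (by linarith)]
    nlinarith [mul_lt_mul_of_pos_left hlt hξₘ.1]
  nlinarith

/-- For `σ` small, no nontrivial profile with compact support starts from zero with vanishing
flux. -/
theorem not_startsZero (hf : IsProfile m σ f) (hm : 1 < m) (hσ : 0 < σ)
    (h0 : f 0 = 0) (hd0 : powDeriv m f 0 = 0) {ξ₁ : ℝ} (hξ₁ : 0 < ξ₁)
    (hpos : ∀ ξ ∈ Ioo 0 ξ₁, 0 < f ξ) (h1 : f ξ₁ = 0)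
    (hsmall₁ : (1 - ((m - 1) / (25 * m)) ^ σ) * (alpha m σ + 2 * beta σ) ≤ beta σ / 2)
    (hsmall₂ : σ * (alpha m σ + beta σ) < beta σ / 2) : False := by
  have hα := alpha_pos hm hσ
  have hβ := beta_pos hσ
  have hm0 : 0 < m := by linarith
  -- The 25 puts `δ` strictly below the constant `(m - 1) / (24 m)` of `le_of_antitoneOn`.
  set δ := (m - 1) / (25 * m) with hδ
  have hδ0 : 0 < δ := div_pos (by linarith) (by linarith)
  have hδ1 : δ < 1 / 25 := by
    rw [hδ, div_lt_div_iff₀ (by positivity) (by norm_num)]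
    linarith
  have hδσ : δ ^ σ ≤ 1 := Real.rpow_le_one hδ0.le (by linarith) hσ.le
  have hfar := hf.lt_interface_rpow hm hσ h0 hξ₁ hpos h1
  obtain ⟨n, hn1⟩ : ∃ n, ξ₁ ^ σ = alpha m σ + beta σ + n := ⟨ξ₁ ^ σ - (alpha m σ + beta σ), by ring⟩
  have hn : beta σ ≤ n := by linarith
  have hn0 : 0 < n := hβ.trans_le hn
  have hδn : alpha m σ + beta σ + n / 2 ≤ (δ * ξ₁) ^ σ := by
    rw [Real.mul_rpow hδ0.le hξ₁.le, hn1]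
    have h2 : (1 - δ ^ σ) * ((alpha m σ + beta σ + n) * beta σ) ≤ n / 2 * beta σ := by
      -- No upper bound on `n` is available; `n ≥ β` makes the ratio of `ξ₁^σ` to `n` largest at `n
      -- = β`, which reduces the claim to `hsmall₁`.
      have h3 : (alpha m σ + beta σ + n) * beta σ ≤ n * (alpha m σ + 2 * beta σ) := by nlinarith
      calc (1 - δ ^ σ) * ((alpha m σ + beta σ + n) * beta σ)
          ≤ (1 - δ ^ σ) * (n * (alpha m σ + 2 * beta σ)) :=
            mul_le_mul_of_nonneg_left h3 (by linarith)
        _ = n * ((1 - δ ^ σ) * (alpha m σ + 2 * beta σ)) := by ring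
        _ ≤ n * (beta σ / 2) := mul_le_mul_of_nonneg_left hsmall₁ hn0.le
        _ = n / 2 * beta σ := by ring
    have h4 : (1 - δ ^ σ) * (alpha m σ + beta σ + n) ≤ n / 2 :=
      le_of_mul_le_mul_right (by linarith) hβ
    linarith
  have hs0 : 0 < δ * ξ₁ := mul_pos hδ0 hξ₁
  obtain ⟨ξₘ, hξₘ, hmono, hanti⟩ := hf.exists_monotoneOn_antitoneOn hm hσ h0 hξ₁ hpos h1
  rcases le_total ξₘ (δ * ξ₁) with hcase | hcase
  · have h5 := hf.le_of_antitoneOn hm hσ hξ₁ hpos h1 hn hn1 hs0 (by nlinarith)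
      (fun t ht => hδn.trans (Real.rpow_le_rpow hs0.le ht.1 hσ.le))
      (hanti.mono (Icc_subset_Icc_left hcase))
    have h6 := le_of_mul_le_mul_right h5 hξ₁
    rw [hδ, div_le_div_iff₀ (by positivity) (by positivity)] at h6
    nlinarith
  · have h7 := hf.peak_rpow_le hm hσ hd0 hpos h1 hξₘ hmono
    have h8 := Real.rpow_le_rpow hs0.le hcase hσ.le
    nlinarith

end IsProfile

/-- Both smallness conditions hold for all sufficiently small `σ`. -/
theorem exists_small (m : ℝ) (hm : 1 < m) :
    ∃ σ₀ : ℝ, 0 < σ₀ ∧ ∀ σ ∈ Ioo 0 σ₀,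
      (1 - ((m - 1) / (25 * m)) ^ σ) * (alpha m σ + 2 * beta σ) ≤ beta σ / 2 ∧
      σ * (alpha m σ + beta σ) < beta σ / 2 := by
  have hm1 : 0 < m - 1 := by linarith
  have hδ0 : 0 < (m - 1) / (25 * m) := div_pos hm1 (by linarith)
  have hc : Continuous fun σ : ℝ => ((m - 1) / (25 * m)) ^ σ := Real.continuous_const_rpow hδ0.ne'
  -- Divided by `β`, both conditions have left sides that are continuous in `σ` and vanish at `σ =
  -- 0`.
  have e1 : ∀ᶠ σ in 𝓝 (0 : ℝ),
      (1 - ((m - 1) / (25 * m)) ^ σ) * ((σ + 2) / (m - 1) + 2) < 1 / 2 := by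
    refine Continuous.continuousAt ?_ |>.eventually_lt continuousAt_const (by simp)
    fun_prop
  have e2 : ∀ᶠ σ in 𝓝 (0 : ℝ), σ * ((σ + 2) / (m - 1) + 1) < 1 / 2 := by
    refine Continuous.continuousAt ?_ |>.eventually_lt continuousAt_const (by simp)
    fun_prop
  obtain ⟨ε, hε, h⟩ := Metric.eventually_nhds_iff.1 (e1.and e2)
  refine ⟨ε, hε, fun σ hσ => ?_⟩
  have hσ0 : 0 < σ := hσ.1
  obtain ⟨h1, h2⟩ := h (y := σ) (by rw [Real.dist_eq, sub_zero, abs_of_pos hσ0]; exact hσ.2)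
  have ha : alpha m σ = (σ + 2) / (m - 1) * beta σ := by
    unfold alpha beta
    field_simp
  have hβ := beta_pos hσ0
  rw [ha]
  constructor
  · nlinarith
  · nlinarith

/-! ### Integrals depending on a parameter -/

/-- Differentiation under the integral sign over a bounded interval, for a jointly continuous
derivative. -/
theorem hasDerivAt_intervalIntegral_of_continuousOn {k k' : ℝ → ℝ → ℝ} {U : Set ℝ} {a b t₀ : ℝ}
    (hU : IsOpen U) (ht₀ : t₀ ∈ U) (hk : ∀ t ∈ U, Continuous fun ξ => k ξ t)
    (hk' : ContinuousOn (Function.uncurry k') (univ ×ˢ U))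
    (hd : ∀ ξ, ∀ t ∈ U, HasDerivAt (k ξ) (k' ξ t) t) :
    HasDerivAt (fun t => ∫ ξ in a..b, k ξ t) (∫ ξ in a..b, k' ξ t₀) t₀ := by
  obtain ⟨ε, hε, hball⟩ := Metric.nhds_basis_closedBall.mem_iff.1 (hU.mem_nhds ht₀)
  have hcomp : IsCompact (uIcc a b ×ˢ Metric.closedBall t₀ ε) :=
    isCompact_uIcc.prod (isCompact_closedBall t₀ ε)
  obtain ⟨C, hC⟩ := hcomp.exists_bound_of_continuousOn
    (hk'.mono (prod_mono (subset_univ _) hball))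
  have hslice : Continuous fun ξ => k' ξ t₀ := by
    have : ContinuousOn (fun ξ : ℝ => Function.uncurry k' (ξ, t₀)) univ :=
      hk'.comp (by fun_prop) fun ξ _ => ⟨mem_univ _, ht₀⟩
    exact continuousOn_univ.1 this
  refine (intervalIntegral.hasDerivAt_integral_of_dominated_loc_of_deriv_le
    (F := fun t ξ => k ξ t) (F' := fun t ξ => k' ξ t) (bound := fun _ => C)
    (Metric.closedBall_mem_nhds t₀ hε) ?_ ?_ ?_ ?_ ?_ ?_).2
  · filter_upwards [hU.mem_nhds ht₀] with t ht using (hk t ht).aestronglyMeasurable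
  · exact (hk t₀ ht₀).intervalIntegrable _ _
  · exact hslice.aestronglyMeasurable
  · exact Eventually.of_forall fun ξ hξ t ht => hC (ξ, t) ⟨uIoc_subset_uIcc hξ, ht⟩
  · simp
  · exact Eventually.of_forall fun ξ _ t ht => hd ξ t (hball ht)

theorem continuousOn_intervalIntegral_of_continuousOn {k : ℝ → ℝ → ℝ} {U : Set ℝ}
    {a b c d : ℝ} (hcd : c ≤ d) (hU : Icc c d ⊆ U)
    (hk : ContinuousOn (Function.uncurry k) (univ ×ˢ U)) :
    ContinuousOn (fun t => ∫ ξ in a..b, k ξ t) (Icc c d) := by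
  -- Clamping the time to `[c, d]` makes the integrand jointly continuous on the whole plane.
  have hcont : Continuous (Function.uncurry fun t ξ => k ξ (projIcc c d hcd t : ℝ)) := by
    have : ContinuousOn (fun z : ℝ × ℝ => Function.uncurry k (z.2, (projIcc c d hcd z.1 : ℝ)))
        univ := by
      refine hk.comp (Continuous.continuousOn ?_) fun z _ => ⟨mem_univ _, hU (projIcc c d hcd z.1).2⟩
      exact continuous_snd.prodMk
        (continuous_subtype_val.comp (continuous_projIcc.comp continuous_fst))
    exact continuousOn_univ.1 this
  have h := intervalIntegral.continuous_parametric_intervalIntegral_of_continuous'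
    (μ := MeasureTheory.volume) hcont a b
  refine h.continuousOn.congr fun t ht => ?_
  simp [projIcc_of_mem hcd ht]

/-! ### Weak form of the profile equation -/

/-- The profile equation tested on a half line. -/
theorem IsGoodProfile.integral_test_half {m σ : ℝ} {f : ℝ → ℝ} (hf : IsGoodProfile m σ f)
    (hσ : 0 < σ) {p p₁ p₂ : ℝ → ℝ} (hp : ∀ ξ, HasDerivAt p (p₁ ξ) ξ)
    (hp₁ : ∀ ξ, HasDerivAt p₁ (p₂ ξ) ξ) (hp₂ : Continuous p₂) {R : ℝ} (hR : 0 ≤ R)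
    (hpR : p R = 0) (hp₁R : p₁ R = 0) :
    ∫ ξ in (0 : ℝ)..R, (f ξ ^ m * p₂ ξ - beta σ * ξ * f ξ * p₁ ξ
      - (alpha m σ + beta σ - ξ ^ σ) * f ξ * p ξ) = -(f 0 ^ m * p₁ 0) := by
  have hsub : Icc 0 R ⊆ Ici 0 := fun x hx => hx.1
  have hcp : Continuous p := continuous_iff_continuousAt.2 fun ξ => (hp ξ).continuousAt
  have hcp₁ : Continuous p₁ := continuous_iff_continuousAt.2 fun ξ => (hp₁ ξ).continuousAt
  have hcf := hf.1.continuousOn.mono hsub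
  have hcw := hf.1.continuousOn_pow.mono hsub
  rw [intervalIntegral.integral_eq_sub_of_hasDerivAt_of_le
    (f := fun ξ => f ξ ^ m * p₁ ξ - flux m σ f ξ * p ξ) hR]
  · simp [hpR, hp₁R, hf.flux_zero]
  · exact (hcw.mul hcp₁.continuousOn).sub ((hf.1.continuousOn_flux.mono hsub).mul hcp.continuousOn)
  · intro ξ hξ
    refine (((hf.1.hasDerivAt_pow hξ.1).mul (hp₁ ξ)).sub
      ((hf.1.hasDerivAt_flux hξ.1).mul (hp ξ))).congr_deriv ?_
    simp only [flux]
    ring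
  · refine ContinuousOn.intervalIntegrable_of_Icc hR (((hcw.mul hp₂.continuousOn).sub
      (ContinuousOn.mul (ContinuousOn.mul (by fun_prop) hcf) hcp₁.continuousOn)).sub
      (((hf.1.continuousOn_reaction hσ).mono hsub).mul hcp.continuousOn))

theorem IsProfile.continuous_comp_abs {m σ : ℝ} {f : ℝ → ℝ} (hf : IsProfile m σ f) :
    Continuous fun ξ => f |ξ| :=
  hf.continuousOn.comp_continuous continuous_abs fun ξ => abs_nonneg ξ

/-- The equation for the even extension of a good profile, tested on the whole line. -/
theorem IsGoodProfile.integral_test {m σ : ℝ} {f : ℝ → ℝ} (hf : IsGoodProfile m σ f)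
    (hm : 1 < m) (hσ : 0 < σ) {p p₁ p₂ : ℝ → ℝ} (hp : ∀ ξ, HasDerivAt p (p₁ ξ) ξ)
    (hp₁ : ∀ ξ, HasDerivAt p₁ (p₂ ξ) ξ) (hp₂ : Continuous p₂) {R : ℝ} (hR : 0 ≤ R)
    (hpR : p R = 0) (hp₁R : p₁ R = 0) (hpR' : p (-R) = 0) (hp₁R' : p₁ (-R) = 0) :
    ∫ ξ in (-R)..R, (f |ξ| ^ m * p₂ ξ - beta σ * ξ * f |ξ| * p₁ ξ
      - (alpha m σ + beta σ - |ξ| ^ σ) * f |ξ| * p ξ) = 0 := by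
  have hcp : Continuous p := continuous_iff_continuousAt.2 fun ξ => (hp ξ).continuousAt
  have hcp₁ : Continuous p₁ := continuous_iff_continuousAt.2 fun ξ => (hp₁ ξ).continuousAt
  have hcf := hf.1.continuous_comp_abs
  set g : ℝ → ℝ := fun ξ => f |ξ| ^ m * p₂ ξ - beta σ * ξ * f |ξ| * p₁ ξ
      - (alpha m σ + beta σ - |ξ| ^ σ) * f |ξ| * p ξ with hg
  have hgc : Continuous g := by
    have h1 : Continuous fun ξ => f |ξ| ^ m :=
      hcf.rpow_const fun ξ => Or.inr (by linarith)
    have h2 : Continuous fun ξ : ℝ => |ξ| ^ σ := continuous_abs.rpow_const fun ξ => Or.inr hσ.le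
    exact ((h1.mul hp₂).sub (((continuous_const.mul continuous_id).mul hcf).mul hcp₁)).sub
      (((continuous_const.sub h2).mul hcf).mul hcp)
  rw [← intervalIntegral.integral_add_adjacent_intervals (b := 0) (hgc.intervalIntegrable _ _)
    (hgc.intervalIntegrable _ _)]
  have hright : ∫ ξ in (0 : ℝ)..R, g ξ = -(f 0 ^ m * p₁ 0) := by
    rw [← hf.integral_test_half hσ hp hp₁ hp₂ hR hpR hp₁R]
    refine intervalIntegral.integral_congr fun ξ hξ => ?_
    rw [uIcc_of_le hR] at hξ
    simp only [hg, abs_of_nonneg hξ.1]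
  -- Reflection reduces this to the half-line identity for `p(-ξ)`; its boundary term at the origin
  -- has the opposite sign and cancels the one from the right.
  have hleft : ∫ ξ in (-R)..0, g ξ = f 0 ^ m * p₁ 0 := by
    have h1 : ∫ ξ in (-R)..0, g ξ = ∫ ξ in (0 : ℝ)..R, g (-ξ) := by
      rw [intervalIntegral.integral_comp_neg g, neg_zero]
    have hq : ∀ ξ, HasDerivAt (fun s => p (-s)) (-p₁ (-ξ)) ξ := fun ξ => by
      simpa [Function.comp_def] using (hp (-ξ)).scomp ξ (hasDerivAt_neg ξ)
    have hq₁ : ∀ ξ, HasDerivAt (fun s => -p₁ (-s)) (p₂ (-ξ)) ξ := fun ξ => by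
      have h := ((hp₁ (-ξ)).scomp ξ (hasDerivAt_neg ξ)).neg
      simpa [Function.comp_def, Pi.neg_def] using h
    have h2 := hf.integral_test_half hσ hq hq₁ (hp₂.comp continuous_neg) hR hpR' (by simp [hp₁R'])
    rw [h1, ← neg_neg (f 0 ^ m * p₁ 0)]
    simp only [neg_zero, mul_neg, neg_neg] at h2 ⊢
    rw [← h2]
    refine intervalIntegral.integral_congr fun ξ hξ => ?_
    rw [uIcc_of_le hR] at hξ
    simp only [hg, abs_neg, abs_of_nonneg hξ.1]
    ring
  rw [hleft, hright]
  ring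

/-! ### Test functions on the strip -/

/-- The partial derivative with respect to the first variable. -/
noncomputable def partialX (Φ : ℝ × ℝ → ℝ) (z : ℝ × ℝ) : ℝ := fderiv ℝ Φ z (1, 0)

/-- The partial derivative with respect to the second variable. -/
noncomputable def partialT (Φ : ℝ × ℝ → ℝ) (z : ℝ × ℝ) : ℝ := fderiv ℝ Φ z (0, 1)

section Partial

variable {Φ : ℝ × ℝ → ℝ}

theorem contDiff_partialX (hΦ : ContDiff ℝ ∞ Φ) : ContDiff ℝ ∞ (partialX Φ) :=
  (hΦ.fderiv_right le_rfl).clm_apply contDiff_const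

theorem contDiff_partialT (hΦ : ContDiff ℝ ∞ Φ) : ContDiff ℝ ∞ (partialT Φ) :=
  (hΦ.fderiv_right le_rfl).clm_apply contDiff_const

theorem tsupport_partialX_subset : tsupport (partialX Φ) ⊆ tsupport Φ :=
  (closure_mono (t := Function.support (fderiv ℝ Φ)) fun z hz h =>
    Function.mem_support.1 hz (by simp [partialX, h])).trans (tsupport_fderiv_subset ℝ)

theorem tsupport_partialT_subset : tsupport (partialT Φ) ⊆ tsupport Φ :=
  (closure_mono (t := Function.support (fderiv ℝ Φ)) fun z hz h =>
    Function.mem_support.1 hz (by simp [partialT, h])).trans (tsupport_fderiv_subset ℝ)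

theorem hasDerivAt_along (hΦ : ContDiff ℝ ∞ Φ) {c : ℝ → ℝ} {c' t : ℝ} (hc : HasDerivAt c c' t) :
    HasDerivAt (fun s => Φ (c s, s)) (c' * partialX Φ (c t, t) + partialT Φ (c t, t)) t := by
  have h := HasFDerivAt.comp_hasDerivAt (f := fun s => (c s, s)) t
    ((hΦ.differentiable (by simp)) (c t, t)).hasFDerivAt (hc.prodMk (hasDerivAt_id t))
  refine h.congr_deriv ?_
  have : ((c', 1) : ℝ × ℝ) = c' • (1, 0) + (0, 1) := by simp
  rw [this, map_add, map_smul]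
  rfl

theorem hasDerivAt_partialX (hΦ : ContDiff ℝ ∞ Φ) (x t : ℝ) :
    HasDerivAt (fun y => Φ (y, t)) (partialX Φ (x, t)) x :=
  ((hΦ.differentiable (by simp)) (x, t)).hasFDerivAt.comp_hasDerivAt x
    ((hasDerivAt_id x).prodMk (hasDerivAt_const x t))

theorem hasDerivAt_partialT (hΦ : ContDiff ℝ ∞ Φ) (x t : ℝ) :
    HasDerivAt (fun s => Φ (x, s)) (partialT Φ (x, t)) t := by
  simpa using hasDerivAt_along hΦ (hasDerivAt_const t x)

theorem iteratedDeriv_two_eq_partialX (hΦ : ContDiff ℝ ∞ Φ) (x t : ℝ) :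
    iteratedDeriv 2 (fun y => Φ (y, t)) x = partialX (partialX Φ) (x, t) := by
  have h1 : deriv (fun y => Φ (y, t)) = fun y => partialX Φ (y, t) :=
    funext fun y => (hasDerivAt_partialX hΦ y t).deriv
  rw [iteratedDeriv_succ, iteratedDeriv_one, h1]
  exact (hasDerivAt_partialX (contDiff_partialX hΦ) x t).deriv

end Partial

/-- A compact subset of the strip `ℝ × (0, T)` lies in a compact box in the strip. -/
theorem exists_box {T : ℝ} (hT : 0 < T) {K : Set (ℝ × ℝ)} (hK : IsCompact K)
    (hKT : K ⊆ univ ×ˢ Ioo 0 T) :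
    ∃ R > 0, ∃ a b, 0 < a ∧ a < b ∧ b < T ∧ K ⊆ Icc (-R) R ×ˢ Icc a b := by
  obtain ⟨R, hR⟩ := (hK.image continuous_fst).isBounded.exists_norm_le
  -- The two extra times keep the set nonempty and force `a < b`, even when `K` is empty.
  have hS : IsCompact (Prod.snd '' K ∪ {T / 2, T / 3}) :=
    (hK.image continuous_snd).union (toFinite _).isCompact
  have hne : (Prod.snd '' K ∪ {T / 2, T / 3}).Nonempty := ⟨T / 2, by simp⟩
  have hsub : Prod.snd '' K ∪ {T / 2, T / 3} ⊆ Ioo 0 T := by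
    rintro t (⟨z, hz, rfl⟩ | rfl | rfl)
    · exact (hKT hz).2
    · constructor <;> linarith
    · constructor <;> linarith
  have h2 : T / 2 ∈ Prod.snd '' K ∪ {T / 2, T / 3} := by simp
  have h3 : T / 3 ∈ Prod.snd '' K ∪ {T / 2, T / 3} := by simp
  refine ⟨max R 1, by positivity, sInf (Prod.snd '' K ∪ {T / 2, T / 3}),
    sSup (Prod.snd '' K ∪ {T / 2, T / 3}), (hsub (hS.sInf_mem hne)).1, ?_,
    (hsub (hS.sSup_mem hne)).2, fun z hz => ⟨?_, ?_⟩⟩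
  · linarith [csInf_le hS.bddBelow h3, le_csSup hS.bddAbove h2]
  · have := hR z.1 ⟨z, hz, rfl⟩
    exact abs_le.1 (this.trans (le_max_left _ _))
  · have hz' : z.2 ∈ Prod.snd '' K ∪ {T / 2, T / 3} := Or.inl ⟨z, hz, rfl⟩
    exact ⟨csInf_le hS.bddBelow hz', le_csSup hS.bddAbove hz'⟩

/-- This is the balance of powers of `T - t` between `u_t` and `(u^m)_xx`. -/
theorem alpha_exponent {m σ : ℝ} (hm : 1 < m) (hσ : 0 < σ) :
    alpha m σ * m = alpha m σ + 1 + 2 * beta σ := by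
  have : m - 1 ≠ 0 := by linarith
  unfold alpha beta
  field_simp
  ring

/-! ### The self-similar solution: weak equation and blow-up -/

section SelfSimilar

variable {m σ T : ℝ} {f : ℝ → ℝ}

theorem selfSimilar_rescale {t : ℝ} (ht : t < T) (ξ : ℝ) :
    selfSimilar m σ T f (ξ * (T - t) ^ (-beta σ)) t = (T - t) ^ (-alpha m σ) * f |ξ| := by
  have hτ : 0 < T - t := by linarith
  rw [selfSimilar, abs_mul, abs_of_pos (Real.rpow_pos_of_pos hτ _), mul_assoc,
    ← Real.rpow_add hτ, neg_add_cancel, Real.rpow_zero, mul_one]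

theorem selfSimilar_nonneg (hf : IsProfile m σ f) {t : ℝ} (ht : t < T) (x : ℝ) :
    0 ≤ selfSimilar m σ T f x t := by
  have hτ : 0 < T - t := by linarith
  exact mul_nonneg (Real.rpow_nonneg hτ.le _) (hf.nonneg _ (by positivity))

theorem continuousOn_selfSimilar (hf : IsProfile m σ f) :
    ContinuousOn (Function.uncurry (selfSimilar m σ T f)) (univ ×ˢ Iio T) := by
  have hτ : ∀ q : ℝ, ContinuousOn (fun z : ℝ × ℝ => (T - z.2) ^ q) (univ ×ˢ Iio T) := fun q =>
    ContinuousOn.rpow_const (by fun_prop) fun z hz => Or.inl (by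
      have : z.2 < T := hz.2
      linarith)
  refine (hτ _).mul (hf.continuousOn.comp
    ((continuous_abs.comp continuous_fst).continuousOn.mul (hτ _)) fun z hz => ?_)
  have : z.2 < T := hz.2
  exact mul_nonneg (abs_nonneg _) (Real.rpow_nonneg (by linarith) _)

/-- The integrand of `∫ u φ dx` in the self-similar variable. -/
noncomputable def scaledPairing (m σ T : ℝ) (f : ℝ → ℝ) (Φ : ℝ × ℝ → ℝ) (ξ t : ℝ) : ℝ :=
  (T - t) ^ (-alpha m σ - beta σ) * (f |ξ| * Φ (ξ * (T - t) ^ (-beta σ), t))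

/-- The time derivative of `scaledPairing`. -/
noncomputable def scaledPairingDeriv (m σ T : ℝ) (f : ℝ → ℝ) (Φ : ℝ × ℝ → ℝ) (ξ t : ℝ) : ℝ :=
  (alpha m σ + beta σ) * (T - t) ^ (-alpha m σ - beta σ - 1) *
      (f |ξ| * Φ (ξ * (T - t) ^ (-beta σ), t)) +
    (T - t) ^ (-alpha m σ - beta σ) * (f |ξ| *
      (ξ * (beta σ * (T - t) ^ (-beta σ - 1)) * partialX Φ (ξ * (T - t) ^ (-beta σ), t) +
        partialT Φ (ξ * (T - t) ^ (-beta σ), t)))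

theorem hasDerivAt_sub_rpow {t : ℝ} (ht : t < T) (q : ℝ) :
    HasDerivAt (fun s => (T - s) ^ q) (-q * (T - t) ^ (q - 1)) t := by
  have hτ : T - t ≠ 0 := by linarith
  refine (((hasDerivAt_id t).const_sub T).rpow_const (p := q) (Or.inl hτ)).congr_deriv ?_
  simp

theorem hasDerivAt_scaledPairing {Φ : ℝ × ℝ → ℝ} (hΦ : ContDiff ℝ ∞ Φ) (ξ : ℝ) {t : ℝ}
    (ht : t < T) :
    HasDerivAt (scaledPairing m σ T f Φ ξ) (scaledPairingDeriv m σ T f Φ ξ t) t := by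
  refine ((hasDerivAt_sub_rpow ht (-alpha m σ - beta σ)).mul
    ((hasDerivAt_along hΦ ((hasDerivAt_sub_rpow ht (-beta σ)).const_mul ξ)).const_mul
      (f |ξ|))).congr_deriv ?_
  simp only [scaledPairingDeriv]
  ring

theorem continuous_scaledPairing (hf : IsProfile m σ f) {Φ : ℝ × ℝ → ℝ} (hΦ : ContDiff ℝ ∞ Φ)
    (t : ℝ) : Continuous fun ξ => scaledPairing m σ T f Φ ξ t := by
  exact continuous_const.mul (hf.continuous_comp_abs.mul
    (hΦ.continuous.comp (by fun_prop : Continuous fun ξ => (ξ * (T - t) ^ (-beta σ), t))))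

theorem continuousOn_scaledPairingDeriv (hf : IsProfile m σ f) {Φ : ℝ × ℝ → ℝ}
    (hΦ : ContDiff ℝ ∞ Φ) :
    ContinuousOn (Function.uncurry (scaledPairingDeriv m σ T f Φ)) (univ ×ˢ Iio T) := by
  have hτ : ∀ q : ℝ, ContinuousOn (fun z : ℝ × ℝ => (T - z.2) ^ q) (univ ×ˢ Iio T) := fun q =>
    ContinuousOn.rpow_const (by fun_prop) fun z hz => Or.inl (by
      have : z.2 < T := hz.2
      linarith)
  have hfc : ContinuousOn (fun z : ℝ × ℝ => f |z.1|) (univ ×ˢ Iio T) :=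
    (hf.continuous_comp_abs.comp continuous_fst).continuousOn
  have hpt : ContinuousOn (fun z : ℝ × ℝ => (z.1 * (T - z.2) ^ (-beta σ), z.2)) (univ ×ˢ Iio T) :=
    (continuous_fst.continuousOn.mul (hτ _)).prodMk continuous_snd.continuousOn
  have hc : ∀ Ψ : ℝ × ℝ → ℝ, Continuous Ψ →
      ContinuousOn (fun z : ℝ × ℝ => Ψ (z.1 * (T - z.2) ^ (-beta σ), z.2)) (univ ×ˢ Iio T) :=
    fun Ψ hΨ => hΨ.comp_continuousOn hpt
  exact ((continuousOn_const.mul (hτ _)).mul (hfc.mul (hc Φ hΦ.continuous))).add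
    ((hτ _).mul (hfc.mul (((continuous_fst.continuousOn.mul (continuousOn_const.mul (hτ _))).mul
      (hc _ (contDiff_partialX hΦ).continuous)).add (hc _ (contDiff_partialT hΦ).continuous))))

/-- At each time, the equation for `u` tested against `φ` is the time derivative of
`∫ u φ dx`. -/
theorem integral_eq_integral_scaledPairingDeriv (hf : IsGoodProfile m σ f) (hm : 1 < m)
    (hσ : 0 < σ) {φ : ℝ → ℝ → ℝ} (hΦ : ContDiff ℝ ∞ (Function.uncurry φ)) {R t : ℝ} (ht : t < T)
    (hR : 0 < R)
    (hout : ∀ ξ, R ≤ |ξ| → (ξ * (T - t) ^ (-beta σ), t) ∉ tsupport (Function.uncurry φ)) :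
    ∫ x : ℝ, (selfSimilar m σ T f x t * deriv (fun s => φ x s) t
        + selfSimilar m σ T f x t ^ m * iteratedDeriv 2 (fun y => φ y t) x
        + |x| ^ σ * selfSimilar m σ T f x t * φ x t)
      = ∫ ξ in (-R)..R, scaledPairingDeriv m σ T f (Function.uncurry φ) ξ t := by
  set Φ := Function.uncurry φ with hΦdef
  have hτ : 0 < T - t := by linarith
  set τ := T - t with hτdef
  set A := τ ^ (-alpha m σ) with hA
  set B := τ ^ (-beta σ) with hB
  have hA0 : 0 < A := Real.rpow_pos_of_pos hτ _
  have hB0 : 0 < B := Real.rpow_pos_of_pos hτ _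
  have hAB : τ ^ (-alpha m σ - beta σ) = A * B := by
    rw [sub_eq_add_neg, Real.rpow_add hτ]
  have hAB1 : τ ^ (-alpha m σ - beta σ - 1) = A * B * τ⁻¹ := by
    rw [Real.rpow_sub_one hτ.ne', hAB, div_eq_mul_inv]
  have hB1 : τ ^ (-beta σ - 1) = B * τ⁻¹ := by
    rw [Real.rpow_sub_one hτ.ne', div_eq_mul_inv]
  have hAm : A ^ m = A * τ⁻¹ * B ^ 2 := by
    rw [hA, ← Real.rpow_mul hτ.le, hB, ← Real.rpow_natCast, ← Real.rpow_mul hτ.le,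
      ← Real.rpow_neg_one τ, ← Real.rpow_add hτ, ← Real.rpow_add hτ]
    congr 1
    push_cast
    linarith [alpha_exponent hm hσ]
  have hBσ : B ^ σ = τ⁻¹ := by
    rw [hB, ← Real.rpow_mul hτ.le, ← Real.rpow_neg_one]
    congr 1
    unfold beta
    field_simp
  have hX := contDiff_partialX hΦ
  have hXX := contDiff_partialX hX
  have hzero : ∀ (Ψ : ℝ × ℝ → ℝ), tsupport Ψ ⊆ tsupport Φ → ∀ ξ, R ≤ |ξ| → Ψ (ξ * B, t) = 0 :=
    fun Ψ hΨ ξ hξ => image_eq_zero_of_notMem_tsupport fun h => hout ξ hξ (hΨ h)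
  have hX0 := hzero _ tsupport_partialX_subset
  have hXX0 := hzero _ (tsupport_partialX_subset.trans tsupport_partialX_subset)
  have hT0 := hzero _ tsupport_partialT_subset
  have hΦ0 := hzero _ subset_rfl
  set g : ℝ → ℝ := fun x => selfSimilar m σ T f x t * deriv (fun s => φ x s) t
        + selfSimilar m σ T f x t ^ m * iteratedDeriv 2 (fun y => φ y t) x
        + |x| ^ σ * selfSimilar m σ T f x t * φ x t with hg
  have hgB : ∀ ξ, g (ξ * B) = A * (f |ξ| * partialT Φ (ξ * B, t))
      + A * τ⁻¹ * (B ^ 2 * f |ξ| ^ m * partialX (partialX Φ) (ξ * B, t))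
      + A * τ⁻¹ * (|ξ| ^ σ * f |ξ| * Φ (ξ * B, t)) := by
    intro ξ
    have h1 : deriv (fun s => φ (ξ * B) s) t = partialT Φ (ξ * B, t) :=
      (hasDerivAt_partialT hΦ (ξ * B) t).deriv
    have h2 : iteratedDeriv 2 (fun y => φ y t) (ξ * B) = partialX (partialX Φ) (ξ * B, t) :=
      iteratedDeriv_two_eq_partialX hΦ (ξ * B) t
    have h3 : selfSimilar m σ T f (ξ * B) t = A * f |ξ| := selfSimilar_rescale ht ξ
    have h4 : φ (ξ * B) t = Φ (ξ * B, t) := rfl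
    simp only [hg]
    rw [h1, h2, h3, h4, Real.mul_rpow hA0.le (hf.1.nonneg _ (abs_nonneg ξ)), hAm, abs_mul,
      abs_of_pos hB0, Real.mul_rpow (abs_nonneg ξ) hB0.le, hBσ]
    ring
  have hscale : ∫ x, g x = B * ∫ ξ in (-R)..R, g (ξ * B) := by
    have h1 : ∫ ξ, g (ξ * B) = |B⁻¹| • ∫ x, g x := MeasureTheory.Measure.integral_comp_mul_right g B
    rw [abs_of_pos (inv_pos.2 hB0), smul_eq_mul] at h1
    rw [intervalIntegral.integral_eq_integral_of_support_subset, h1, mul_inv_cancel_left₀ hB0.ne']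
    intro ξ hξ
    by_contra hmem
    have hξR : R ≤ |ξ| := by
      by_contra! hlt
      exact hmem ⟨(abs_lt.1 hlt).1, (abs_lt.1 hlt).2.le⟩
    exact hξ (by simp [hgB, hT0 ξ hξR, hXX0 ξ hξR, hΦ0 ξ hξR])
  -- The rescaled integrand minus the derivative of the pairing is `A B τ⁻¹` times the profile
  -- equation tested with `ξ ↦ Φ(ξ B, t)`, so the two integrals agree.
  have htest := hf.integral_test hm hσ (p := fun ξ => Φ (ξ * B, t))
    (p₁ := fun ξ => B * partialX Φ (ξ * B, t))
    (p₂ := fun ξ => B ^ 2 * partialX (partialX Φ) (ξ * B, t))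
    (fun ξ => by
      have := (hasDerivAt_partialX hΦ (ξ * B) t).comp ξ ((hasDerivAt_id ξ).mul_const B)
      simpa [Function.comp_def, mul_comm] using this)
    (fun ξ => by
      have := ((hasDerivAt_partialX hX (ξ * B) t).comp ξ ((hasDerivAt_id ξ).mul_const B)).const_mul B
      refine this.congr_deriv ?_
      ring)
    (by have := hXX.continuous; fun_prop) hR.le
    (hΦ0 R (le_abs_self R)) (by simp [hX0 R (le_abs_self R)])
    (hΦ0 (-R) (by rw [abs_neg]; exact le_abs_self R))
    (by have := hX0 (-R) (by rw [abs_neg]; exact le_abs_self R); simp only [this, mul_zero])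
  have hfc := hf.1.continuous_comp_abs
  have hcΦ : Continuous fun ξ => Φ (ξ * B, t) := by have := hΦ.continuous; fun_prop
  have hcX : Continuous fun ξ => partialX Φ (ξ * B, t) := by have := hX.continuous; fun_prop
  have hcXX : Continuous fun ξ => partialX (partialX Φ) (ξ * B, t) := by
    have := hXX.continuous; fun_prop
  have hcT : Continuous fun ξ => partialT Φ (ξ * B, t) := by
    have := (contDiff_partialT hΦ).continuous; fun_prop
  have hfm : Continuous fun ξ => f |ξ| ^ m := hfc.rpow_const fun ξ => Or.inr (by linarith)
  have hσc : Continuous fun ξ : ℝ => |ξ| ^ σ := continuous_abs.rpow_const fun ξ => Or.inr hσ.le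
  rw [hscale, ← intervalIntegral.integral_const_mul, ← sub_eq_zero,
    ← intervalIntegral.integral_sub, ← mul_zero (A * B * τ⁻¹), ← htest,
    ← intervalIntegral.integral_const_mul]
  · refine intervalIntegral.integral_congr fun ξ _ => ?_
    simp only [hgB, scaledPairingDeriv, ← hτdef, hAB, hAB1, hB1, ← hB]
    ring
  · refine Continuous.intervalIntegrable ?_ _ _
    simp only [hgB]
    exact continuous_const.mul (((continuous_const.mul (hfc.mul hcT)).add
      (continuous_const.mul ((continuous_const.mul hfm).mul hcXX))).add
      (continuous_const.mul ((hσc.mul hfc).mul hcΦ)))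
  · refine Continuous.intervalIntegrable ?_ _ _
    simp only [scaledPairingDeriv, ← hτdef, ← hB]
    exact (continuous_const.mul (hfc.mul hcΦ)).add (continuous_const.mul
      (hfc.mul (((continuous_id.mul continuous_const).mul hcX).add hcT)))

/-- The self-similar function of a good profile is a weak solution. -/
theorem IsGoodProfile.isWeakSolution (hf : IsGoodProfile m σ f) (hm : 1 < m) (hσ : 0 < σ)
    (hT : 0 < T) : IsWeakSolution m σ T (selfSimilar m σ T f) where
  nonneg x t ht := selfSimilar_nonneg hf.1 ht.2 x
  continuousOn := (continuousOn_selfSimilar hf.1).mono (prod_mono subset_rfl Ico_subset_Iio_self)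
  equation := by
    intro φ hΦ hcomp hsupp
    obtain ⟨R₀, hR₀, a, b, ha, hab, hb, hbox⟩ := exists_box hT hcomp hsupp
    have hβ := beta_pos hσ
    -- One `R` covers the rescaled support at all times, as `(T - t)^β ≤ T^β`; the added 1 makes the
    -- exclusion strict.
    set R := (R₀ + 1) * T ^ beta σ with hR
    have hRpos : 0 < R := mul_pos (by linarith) (Real.rpow_pos_of_pos hT _)
    have hout : ∀ t ∈ Ioo 0 T, ∀ ξ, R ≤ |ξ| →
        (ξ * (T - t) ^ (-beta σ), t) ∉ tsupport (Function.uncurry φ) := by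
      intro t ht ξ hξ hmem
      have hτ : 0 < T - t := by linarith [ht.2]
      have h1 := abs_le.2 (hbox hmem).1
      simp only at h1
      rw [abs_mul, abs_of_pos (Real.rpow_pos_of_pos hτ _), Real.rpow_neg hτ.le,
        ← div_eq_mul_inv, div_le_iff₀ (Real.rpow_pos_of_pos hτ _)] at h1
      have h2 : (T - t) ^ beta σ ≤ T ^ beta σ :=
        Real.rpow_le_rpow hτ.le (by linarith [ht.1]) hβ.le
      have h3 : R₀ * (T - t) ^ beta σ ≤ R₀ * T ^ beta σ := mul_le_mul_of_nonneg_left h2 hR₀.le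
      have h4 := Real.rpow_pos_of_pos hT (beta σ)
      linarith
    -- These times lie inside `(0, T)` but outside `[a, b]`, so the pairing vanishes at both ends.
    set a' := a / 2 with ha'
    set b' := (b + T) / 2 with hb'
    have hab' : a' ≤ b' := by linarith
    have hsub : Icc a' b' ⊆ Iio T := fun t ht => show t < T by linarith [ht.2]
    have hvanish : ∀ t, t ∉ Icc a b → ∀ x, (x, t) ∉ tsupport (Function.uncurry φ) :=
      fun t ht x hx => ht (hbox hx).2
    have hJ : ∀ t ∈ Ioo 0 T, ∫ x : ℝ, (selfSimilar m σ T f x t * deriv (fun s => φ x s) t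
        + selfSimilar m σ T f x t ^ m * iteratedDeriv 2 (fun y => φ y t) x
        + |x| ^ σ * selfSimilar m σ T f x t * φ x t)
        = ∫ ξ in (-R)..R, scaledPairingDeriv m σ T f (Function.uncurry φ) ξ t := fun t ht =>
      integral_eq_integral_scaledPairingDeriv hf hm hσ hΦ ht.2 hRpos (hout t ht)
    rw [MeasureTheory.setIntegral_congr_fun measurableSet_Ioo hJ]
    have hrestrict : ∫ t in Ioo 0 T,
          (∫ ξ in (-R)..R, scaledPairingDeriv m σ T f (Function.uncurry φ) ξ t)
        = ∫ t in Ioc a' b',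
          (∫ ξ in (-R)..R, scaledPairingDeriv m σ T f (Function.uncurry φ) ξ t) := by
      refine MeasureTheory.setIntegral_eq_of_subset_of_forall_sdiff_eq_zero measurableSet_Ioo
        (fun t ht => ⟨by linarith [ht.1], by linarith [ht.2]⟩) fun t ht => ?_
      have hnot : t ∉ Icc a b := fun h => ht.2 ⟨by linarith [h.1], by linarith [h.2]⟩
      have hz : ∀ Ψ : ℝ × ℝ → ℝ, tsupport Ψ ⊆ tsupport (Function.uncurry φ) →
          ∀ x, Ψ (x, t) = 0 :=
        fun Ψ hΨ x => image_eq_zero_of_notMem_tsupport fun h => hvanish t hnot x (hΨ h)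
      simp [scaledPairingDeriv, hz _ tsupport_partialX_subset, hz _ tsupport_partialT_subset,
        hz _ subset_rfl]
    rw [hrestrict, ← intervalIntegral.integral_of_le hab',
      intervalIntegral.integral_eq_sub_of_hasDerivAt
        (f := fun t => ∫ ξ in (-R)..R, scaledPairing m σ T f (Function.uncurry φ) ξ t)]
    · have hz : ∀ t, t ∉ Icc a b → ∀ x, Function.uncurry φ (x, t) = 0 :=
        fun t ht x => image_eq_zero_of_notMem_tsupport (hvanish t ht x)
      have h1 := hz a' fun h => by linarith [h.1]
      have h2 := hz b' fun h => by linarith [h.2]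
      simp only [scaledPairing, h1, h2, mul_zero, intervalIntegral.integral_zero, sub_zero]
    · intro t ht
      rw [uIcc_of_le hab'] at ht
      exact hasDerivAt_intervalIntegral_of_continuousOn isOpen_Iio (hsub ht)
        (fun s _ => continuous_scaledPairing hf.1 hΦ s) (continuousOn_scaledPairingDeriv hf.1 hΦ)
        (fun ξ s hs => hasDerivAt_scaledPairing hΦ ξ hs)
    · exact (continuousOn_intervalIntegral_of_continuousOn hab' hsub
        (continuousOn_scaledPairingDeriv hf.1 hΦ)).intervalIntegrable_of_Icc hab'

/-- The self-similar function of a bounded profile which is positive at the origin blows up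
globally. -/
theorem blowsUpGlobally_selfSimilar (hf : IsProfile m σ f) (hm : 1 < m) (hσ : 0 < σ)
    (hT : 0 < T) (h0 : 0 < f 0) {C : ℝ} (hC : ∀ ξ, 0 ≤ ξ → f ξ ≤ C) :
    BlowsUpGlobally T (selfSimilar m σ T f) := by
  have hα := alpha_pos hm hσ
  have hβ := beta_pos hσ
  refine ⟨fun t ht => ⟨(T - t) ^ (-alpha m σ) * C, fun x => ?_⟩, eq_univ_of_forall fun x => ?_⟩
  · have hτ : 0 < T - t := by linarith [ht.2]
    rw [abs_of_nonneg (selfSimilar_nonneg hf ht.2 x)]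
    exact mul_le_mul_of_nonneg_left (hC _ (by positivity)) (Real.rpow_nonneg hτ.le _)
  · have hlim : Tendsto (fun k : ℕ => T / ((k : ℝ) + 2)) atTop (𝓝 0) :=
      tendsto_const_nhds.div_atTop
        (tendsto_atTop_add_const_right _ _ tendsto_natCast_atTop_atTop)
    have hpos : ∀ k : ℕ, 0 < T / ((k : ℝ) + 2) := fun k => by positivity
    have hlim' : Tendsto (fun k : ℕ => T / ((k : ℝ) + 2)) atTop (𝓝[>] 0) :=
      tendsto_nhdsWithin_iff.2 ⟨hlim, Eventually.of_forall hpos⟩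
    -- The spatial sequence can be constant; the shift by 2 keeps the first time positive.
    refine ⟨fun _ => x, fun k => T - T / ((k : ℝ) + 2), fun k => ⟨?_, ?_⟩, ?_,
      tendsto_const_nhds, ?_⟩
    · have : T / ((k : ℝ) + 2) < T := by
        rw [div_lt_iff₀ (by positivity)]
        nlinarith [(Nat.cast_nonneg k : (0 : ℝ) ≤ k)]
      linarith
    · linarith [hpos k]
    · simpa using tendsto_const_nhds.sub hlim
    · have h1 : Tendsto (fun k : ℕ => (T / ((k : ℝ) + 2)) ^ (-alpha m σ)) atTop atTop :=
        (tendsto_rpow_neg_nhdsGT_zero (neg_neg_of_pos hα)).comp hlim'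
      have h2 : Tendsto (fun k : ℕ => f (|x| * (T / ((k : ℝ) + 2)) ^ beta σ)) atTop (𝓝 (f 0)) := by
        have h3 : Tendsto (fun k : ℕ => |x| * (T / ((k : ℝ) + 2)) ^ beta σ) atTop (𝓝 0) := by
          have h4 := (hlim.rpow_const (p := beta σ) (Or.inr hβ.le)).const_mul |x|
          rwa [Real.zero_rpow hβ.ne', mul_zero] at h4
        exact (hf.continuousOn 0 (mem_Ici.2 le_rfl)).tendsto.comp
          (tendsto_nhdsWithin_iff.2 ⟨h3, Eventually.of_forall fun k =>
            mul_nonneg (abs_nonneg x) (Real.rpow_nonneg (hpos k).le _)⟩)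
      refine tendsto_abs_atTop_atTop.comp ((h1.atTop_mul_pos h0 h2).congr fun k => ?_)
      simp [selfSimilar]

end SelfSimilar

/-- A profile with interface is bounded. -/
theorem IsGoodProfileWithInterface.exists_bound {m σ : ℝ} {f : ℝ → ℝ} (hm : 1 < m) (hσ : 0 < σ)
    (hf : IsGoodProfileWithInterface m σ f) : ∃ C, ∀ ξ, 0 ≤ ξ → f ξ ≤ C := by
  obtain ⟨ξ₁, hξ₁, -, hz⟩ := hf.exists_support hm hσ
  obtain ⟨C, hC⟩ := isCompact_Icc.exists_bound_of_continuousOn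
    (hf.1.1.continuousOn.mono (fun x hx => hx.1 : Icc 0 ξ₁ ⊆ Ici 0))
  refine ⟨C, fun ξ hξ => ?_⟩
  rcases le_total ξ ξ₁ with h | h
  · exact (le_abs_self _).trans (hC ξ ⟨hξ, h⟩)
  · rw [hz ξ h]
    exact (norm_nonneg _).trans (hC 0 ⟨le_rfl, hξ₁.le⟩)

end WeightedReaction

theorem theorem1p2 (m : ℝ) (hm : 1 < m) :
    ∃ σ₀ : ℝ, 0 < σ₀ ∧ ∀ σ ∈ Set.Ioo 0 σ₀, ∀ f : ℝ → ℝ,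
      WeightedReaction.IsGoodProfileWithInterface m σ f →
        (∃ A : ℝ, 0 < A ∧ f 0 = A ∧ HasDerivWithinAt f 0 (Set.Ici 0) 0) ∧
        ∀ T : ℝ, 0 < T →
          WeightedReaction.IsWeakSolution m σ T (WeightedReaction.selfSimilar m σ T f) ∧
          WeightedReaction.BlowsUpGlobally T (WeightedReaction.selfSimilar m σ T f) := by
  obtain ⟨σ₀, hσ₀, hsmall⟩ := WeightedReaction.exists_small m hm
  refine ⟨σ₀, hσ₀, fun σ hσ f hf => ?_⟩
  obtain ⟨hs₁, hs₂⟩ := hsmall σ hσ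
  have hstart : WeightedReaction.StartsPositive f := by
    rcases hf.1.2 with h | h
    · exact h
    · obtain ⟨ξ₁, hξ₁, hpos, hz⟩ := hf.exists_support hm hσ.1
      exact (hf.1.1.not_startsZero hm hσ.1 h.1 hf.1.powDeriv_zero hξ₁ hpos (hz ξ₁ le_rfl)
        hs₁ hs₂).elim
  obtain ⟨C, hC⟩ := hf.exists_bound hm hσ.1
  exact ⟨⟨f 0, hstart.1, rfl, hstart.2⟩, fun T hT => ⟨hf.1.isWeakSolution hm hσ.1 hT,
    WeightedReaction.blowsUpGlobally_selfSimilar hf.1.1 hm hσ.1 hT hstart.1 hC⟩⟩
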